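/- Let $d,r\ge 0$ be integers and let $F\in\mathcal E'(\mathbb C^d)$ be a complex distribution with compact support on $\mathbb C^d\cong\mathbb R^{2d}$. Write $\mathcal A(F)=\big(\langle F,\mathbf z^\alpha\bar{\mathbf z}^\beta\rangle\big)_{\alpha,\beta\in\mathbb Z_+^d}$, where $\mathbb Z_+=\{0,1,2,\dots\}$, and consider the assertion $(*)$ $\operatorname{supp}F$ has at most $r$ points, and $F=\sum_{q=1}^{r}L_q\,\delta(\mathbf z-\mathbf z_q)$ for some points $\mathbf z_1,\dots,\mathbf z_r\in\mathbb C^d$ (not necessarily distinct) and some linear differential operators $L_1,\dots,L_r$ with constant complex coefficients in the real partial derivatives (possibly zero). 1. If the infinite matrix $\mathcal A(F)$ has finite rank $r$, then $(*)$ holds. 2. Let $P\subset\mathbb C^d$ be an open polydisk containing $\operatorname{supp}F$. If for every bounded analytic function $g$ on $P$ the matrix $\mathcal A(|g|^2F)$ of the distribution $|g|^2F$ has rank at most $r$, then $(*)$ holds. -/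

import Mathlib

open TopologicalSpace Distribution LineDeriv Filter Topology
open scoped Distributions ContDiff ComplexConjugate Manifold

noncomputable section

namespace FiniteRank

/-- Complex distributions on `ℂ^d`, regarded as a real vector space of dimension `2 d`. A complex
distribution is a continuous real-linear map from real test functions to `ℂ`. -/
abbrev Dist (d : ℕ) : Type := 𝓓'((⊤ : Opens (Fin d → ℂ)), ℂ)

/-- Real-valued smooth compactly supported test functions on `ℂ^d`. -/
abbrev Test (d : ℕ) : Type := 𝓓((⊤ : Opens (Fin d → ℂ)), ℝ)

section Dimension

variable {d : ℕ}

/-- The pointwise product of a test function by a smooth function. -/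
def mulTest (a : (Fin d → ℂ) → ℝ) (ha : ContDiff ℝ ∞ a) (φ : Test d) : Test d where
  toFun z := a z * φ z
  contDiff' := ha.mul φ.contDiff
  hasCompactSupport' := φ.hasCompactSupport.mul_left
  tsupport_subset' := fun _ _ => trivial

/-- Multiplication by a smooth function is continuous on test functions. -/
def mulTestCLM (a : (Fin d → ℂ) → ℝ) (ha : ContDiff ℝ ∞ a) : Test d →L[ℝ] Test d :=
  TestFunction.limitCLM ℝ (mulTest a ha)
    (fun _ hK => (TestFunction.ofSupportedInCLM ℝ hK).comp
      (ContDiffMapSupportedIn.bilinLeftCLM (ContinuousLinearMap.mul ℝ ℝ) ha))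
    (by
      intro K hK f
      ext z
      change a z * f z = f z * a z
      ring)

@[simp]
theorem mulTestCLM_apply (a : (Fin d → ℂ) → ℝ) (ha : ContDiff ℝ ∞ a) (φ : Test d)
    (z : Fin d → ℂ) : mulTestCLM a ha φ z = a z * φ z := rfl

/-- A distribution vanishes on every test function which is zero near its support. -/
theorem apply_eq_zero_of_eventually (F : Dist d) (φ : Test d)
    (h : ∀ᶠ z in 𝓝ˢ (dsupport F), φ z = 0) : F φ = 0 := by
  have hloc : ∀ x : tsupport φ, ∃ s : Set (Fin d → ℂ), IsVanishingOn F s ∧ IsOpen s ∧ x.1 ∈ s := by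
    intro x
    rw [← notMem_dsupport_iff]
    intro hx
    have h1 : ∀ᶠ z in 𝓝 x.1, φ z = 0 := h.filter_mono (nhds_le_nhdsSet hx)
    exact (notMem_tsupport_iff_eventuallyEq.mpr h1) x.2
  choose U hU hUo hxU using hloc
  obtain ⟨ρ, hρ⟩ := SmoothPartitionOfUnity.exists_isSubordinate 𝓘(ℝ, Fin d → ℂ)
    (isClosed_tsupport φ) U hUo (fun x hx => Set.mem_iUnion.mpr ⟨⟨x, hx⟩, hxU ⟨x, hx⟩⟩)
  have hfin := ρ.locallyFinite.finite_nonempty_inter_compact φ.hasCompactSupport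
  have hsum : φ = ∑ i ∈ hfin.toFinset, mulTestCLM (ρ i) (ρ i).contMDiff.contDiff φ := by
    ext z
    have hcoe : ∀ t : Finset (tsupport φ),
        (∑ i ∈ t, mulTestCLM (ρ i) (ρ i).contMDiff.contDiff φ : Test d) z
          = (∑ i ∈ t, ρ i z) * φ z := by
      classical
      intro t
      induction t using Finset.induction_on with
      | empty => rw [Finset.sum_empty, Finset.sum_empty, zero_mul]; rfl
      | insert a t ha ih =>
        rw [Finset.sum_insert ha, Finset.sum_insert ha, add_mul, ← ih]
        rfl
    rw [hcoe]
    by_cases hz : z ∈ tsupport φ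
    · have h1 := ρ.sum_eq_one hz
      rw [finsum_eq_sum_of_support_subset (s := hfin.toFinset)] at h1
      · rw [h1, one_mul]
      · intro i hi
        rw [Finset.mem_coe, Set.Finite.mem_toFinset]
        exact ⟨z, hi, hz⟩
    · rw [image_eq_zero_of_notMem_tsupport hz, mul_zero]
  rw [hsum, map_sum]
  refine Finset.sum_eq_zero fun i _ => hU i _ ?_
  exact (tsupport_mul_subset_left (f := ρ i) (g := φ)).trans (hρ i)

/-- The value of a distribution depends only on the test function near the support. -/
theorem apply_congr (F : Dist d) (φ ψ : Test d)
    (h : ∀ᶠ z in 𝓝ˢ (dsupport F), φ z = ψ z) : F φ = F ψ := by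
  rw [← sub_eq_zero, ← map_sub]
  refine apply_eq_zero_of_eventually F _ (h.mono fun z hz => ?_)
  change φ z - ψ z = 0
  rw [hz, sub_self]

open Classical in
/-- The pairing `⟨F, f⟩` of a compactly supported distribution with a complex function `f` that is
smooth near the support of `F`: it is `F φ + i F ψ` for any test functions `φ, ψ` such that
`f = φ + i ψ` in a neighbourhood of the support of `F`. -/
def pairing (F : Dist d) (f : (Fin d → ℂ) → ℂ) : ℂ :=
  if h : ∃ p : Test d × Test d, ∀ᶠ z in 𝓝ˢ (dsupport F), f z = p.1 z + Complex.I * p.2 z then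
    F h.choose.1 + Complex.I * F h.choose.2
  else 0

/-- The pairing does not depend on the chosen test functions. -/
theorem pairing_eq (F : Dist d) (f : (Fin d → ℂ) → ℂ) (φ ψ : Test d)
    (h : ∀ᶠ z in 𝓝ˢ (dsupport F), f z = φ z + Complex.I * ψ z) :
    pairing F f = F φ + Complex.I * F ψ := by
  have hex : ∃ p : Test d × Test d, ∀ᶠ z in 𝓝ˢ (dsupport F), f z = p.1 z + Complex.I * p.2 z :=
    ⟨(φ, ψ), h⟩
  rw [pairing, dif_pos hex]
  have key : ∀ᶠ z in 𝓝ˢ (dsupport F),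
      hex.choose.1 z = φ z ∧ hex.choose.2 z = ψ z := by
    filter_upwards [h, hex.choose_spec] with z h1 h2
    rw [h1] at h2
    have hr := congrArg Complex.re h2
    have hi := congrArg Complex.im h2
    simp at hr hi
    exact ⟨hr.symm, hi.symm⟩
  rw [apply_congr F _ φ (key.mono fun _ h => h.1), apply_congr F _ ψ (key.mono fun _ h => h.2)]

/-- The infinite matrix with entries `⟨F, z^α z̄^β⟩`, indexed by multi-indices `α, β`. -/
def momentMatrix (F : Dist d) : Matrix (Fin d → ℕ) (Fin d → ℕ) ℂ :=
  Matrix.of fun α β => pairing F fun z => (∏ i, z i ^ α i) * ∏ i, conj (z i) ^ β i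

open Classical in
/-- The product `a F` of a compactly supported distribution with a real function `a` that is smooth
near the support of `F`: `(a F) φ = F (b φ)` for any smooth `b` on `ℂ^d` that equals `a` in a
neighbourhood of the support of `F`. -/
def mulNear (a : (Fin d → ℂ) → ℝ) (F : Dist d) : Dist d :=
  if h : ∃ b : (Fin d → ℂ) → ℝ, ContDiff ℝ ∞ b ∧ ∀ᶠ z in 𝓝ˢ (dsupport F), b z = a z then
    (mulTestCLM h.choose h.choose_spec.1).precompCompactConvergenceCLM ℂ F
  else 0

/-- The product does not depend on the chosen smooth extension. -/
theorem mulNear_apply (a : (Fin d → ℂ) → ℝ) (F : Dist d) (b : (Fin d → ℂ) → ℝ)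
    (hb : ContDiff ℝ ∞ b) (h : ∀ᶠ z in 𝓝ˢ (dsupport F), b z = a z) (φ : Test d) :
    mulNear a F φ = F (mulTestCLM b hb φ) := by
  have hex : ∃ b : (Fin d → ℂ) → ℝ, ContDiff ℝ ∞ b ∧ ∀ᶠ z in 𝓝ˢ (dsupport F), b z = a z :=
    ⟨b, hb, h⟩
  rw [mulNear, dif_pos hex]
  change F (mulTestCLM hex.choose hex.choose_spec.1 φ) = _
  refine apply_congr F _ _ ?_
  filter_upwards [h, hex.choose_spec.2] with z h1 h2
  rw [mulTestCLM_apply, mulTestCLM_apply, h1, h2]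

/-- The delta distribution at a point of `ℂ^d`. -/
def diracAt (w : Fin d → ℂ) : Dist d :=
  Distribution.mapCLM Complex.ofRealCLM (Distribution.delta w)

/-- A linear differential operator with constant complex coefficients on `ℂ^d = ℝ^{2d}`: a finite
linear combination of iterated directional derivatives, each indexed by the tuple of its
directions. -/
abbrev DiffOp (d : ℕ) : Type := (Σ n : ℕ, Fin n → (Fin d → ℂ)) →₀ ℂ

/-- The action of a differential operator on distributions. -/
def DiffOp.apply (L : DiffOp d) (T : Dist d) : Dist d :=
  L.sum fun m c => c • (∂^{m.2} T : Dist d)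

/-- `F = ∑_{1 ≤ q ≤ r} L_q δ(z - z_q)` for some points `z_q` and differential operators `L_q`. -/
def IsSumOfDeltas (r : ℕ) (F : Dist d) : Prop :=
  ∃ (w : Fin r → (Fin d → ℂ)) (L : Fin r → DiffOp d), F = ∑ q, (L q).apply (diracAt (w q))

/-- The open polydisk with centre `c` and polyradius `R`. -/
def polydisk (c : Fin d → ℂ) (R : Fin d → ℝ) : Set (Fin d → ℂ) :=
  {z | ∀ i, ‖z i - c i‖ < R i}

end Dimension

end FiniteRank

end

/-!
The second assertion follows from the first with `g = 1`, for which `|g|² F = F`. So let `F` have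
compact support and a moment matrix of rank at most `r`.

Cutting off by a test function that is `1` near the support extends `F` to a complex-linear
functional `P` on all smooth functions which is bounded by finitely many derivatives on a compact
set (`JetBounded`). Its Fourier-Laplace transform `Φ (a, b) = ⟨P, exp (a · z + b · z̄)⟩` is entire,
and by expanding exponentials in monomials all its minors of size `r + 1` vanish
(`MomentRankLE.det_minor_laplace`). Conversely `Φ` determines `P` on compactly supported functions,
by Fourier inversion (`JetBounded.eq_zero_of_map_expFun`).

*The support is finite.* Along a coordinate vector `v` the function
`s ↦ Φ (a + s v, b - s̄ v)` has polynomial growth, because `s z_i - s̄ z̄_i` is imaginary. Let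
`(x₀, y₀)` be a nonvanishing minor of maximal size. Then `det Φ (x + s v, y₀ - s̄ v)` is, up to a
constant, the product of `det Φ (x + s v, y₀)`, holomorphic in `s`, and `det Φ (x₀, y₀ - s̄ v)`,
antiholomorphic in `s`. Replacing the second factor by its conjugate does not change the modulus,
and gives an entire function of polynomial growth, that is, a polynomial, of degree bounded
independently of `x`. A vanishing iterated difference of it is a linear recurrence for
`det Φ (x, y₀)` under translation of `x` by a small multiple of `v`, and therefore one for `Φ`
itself (`exists_recurrence`). It says that `p (exp (c z_i)) F = 0` for some `c ≠ 0` and some monic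
polynomial `p` (`JetBounded.exists_annihilator`). Hence `p (exp (c z_i))` vanishes on the support
of `F`, so each coordinate takes finitely many values there (`finite_dsupport`).

*Structure.* A functional of finite order supported on a finite set annihilates functions that are
flat of high order at its points (`JetBounded.exists_eq_zero_of_flatAt`), hence is a linear
combination of derivatives of delta distributions (`exists_eq_sum_apply_diracAt`).

*The number of points.* For each point of the support there are a polynomial in `z` and one in `z̄`
which are `1` to high order at this point and `0` to high order at the others. Multiplied by
monomials detecting `F` near the point, they exhibit a diagonal block of the moment form with
nonzero entries, of size the number of points (`card_le_of_momentRankLE`).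
-/


noncomputable section

namespace FiniteRank

/-! ### Functionals bounded by jets and their values on exponentials -/

section JetBounded

variable {E : Type*} [NormedAddCommGroup E] [NormedSpace ℝ E]

/-- The algebra of complex-valued smooth functions on a real normed space. -/
def Smooth (E : Type*) [NormedAddCommGroup E] [NormedSpace ℝ E] : Subalgebra ℂ (E → ℂ) where
  carrier := {f | ContDiff ℝ ∞ f}
  mul_mem' {f g} (hf : ContDiff ℝ ∞ f) (hg : ContDiff ℝ ∞ g) := hf.mul hg
  add_mem' {f g} (hf : ContDiff ℝ ∞ f) (hg : ContDiff ℝ ∞ g) := hf.add hg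
  algebraMap_mem' c := (contDiff_const : ContDiff ℝ ∞ fun _ : E => c)

theorem Smooth.contDiff (f : Smooth E) : ContDiff ℝ ∞ (f : E → ℂ) := f.2

/-- A linear functional on smooth functions is jet-bounded if it is controlled by finitely many
derivatives on a compact set, i.e. if it is a compactly supported distribution (of finite order).
The bound is expressed through a common upper bound `A` of the derivatives rather than through
suprema. -/
def JetBounded (P : Smooth E →ₗ[ℂ] ℂ) : Prop :=
  ∃ (K : Set E) (N : ℕ) (C : ℝ), IsCompact K ∧ ∀ (f : Smooth E) (A : ℝ), 0 ≤ A →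
    (∀ k ≤ N, ∀ z ∈ K, ‖iteratedFDeriv ℝ k (f : E → ℂ) z‖ ≤ A) → ‖P f‖ ≤ C * A

theorem Smooth.exists_jet_bound (g : Smooth E) {K : Set E} (hK : IsCompact K) (N : ℕ) :
    ∃ B : ℝ, 0 ≤ B ∧ ∀ k ≤ N, ∀ z ∈ K, ‖iteratedFDeriv ℝ k (g : E → ℂ) z‖ ≤ B := by
  have h : ∀ k : ℕ, ∃ B : ℝ, ∀ z ∈ K, ‖iteratedFDeriv ℝ k (g : E → ℂ) z‖ ≤ B := fun k =>
    hK.exists_bound_of_continuousOn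
      ((Smooth.contDiff g).continuous_iteratedFDeriv (m := k) (mod_cast le_top)).continuousOn
  choose B hB using h
  refine ⟨∑ k ∈ Finset.range (N + 1), |B k|, Finset.sum_nonneg fun _ _ => abs_nonneg _, ?_⟩
  intro k hk z hz
  refine (hB k z hz).trans ((le_abs_self _).trans ?_)
  exact Finset.single_le_sum (f := fun k => |B k|) (fun _ _ => abs_nonneg _)
    (Finset.mem_range.mpr (by omega))

theorem Smooth.norm_iteratedFDeriv_mul_le {g f : Smooth E} {N : ℕ} {z : E} {A B : ℝ} (hA0 : 0 ≤ A)
    (hB0 : 0 ≤ B) (hB : ∀ k ≤ N, ‖iteratedFDeriv ℝ k (g : E → ℂ) z‖ ≤ B)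
    (hA : ∀ k ≤ N, ‖iteratedFDeriv ℝ k (f : E → ℂ) z‖ ≤ A) {k : ℕ} (hk : k ≤ N) :
    ‖iteratedFDeriv ℝ k ((g * f : Smooth E) : E → ℂ) z‖ ≤ 2 ^ N * B * A := by
  refine (_root_.norm_iteratedFDeriv_mul_le (Smooth.contDiff g) (Smooth.contDiff f) z
    (mod_cast le_top)).trans ?_
  calc ∑ i ∈ Finset.range (k + 1), (k.choose i : ℝ) * ‖iteratedFDeriv ℝ i (g : E → ℂ) z‖
        * ‖iteratedFDeriv ℝ (k - i) (f : E → ℂ) z‖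
      ≤ ∑ i ∈ Finset.range (k + 1), (k.choose i : ℝ) * B * A := by
        refine Finset.sum_le_sum fun i hi => ?_
        have hi' := Finset.mem_range.mp hi
        gcongr
        · exact hB i (by omega)
        · exact hA _ (by omega)
    _ = 2 ^ k * B * A := by
        rw [← Finset.sum_mul, ← Finset.sum_mul]
        norm_cast
        rw [Nat.sum_range_choose]
    _ ≤ 2 ^ N * B * A := by
        gcongr
        norm_num

/-- The product of a jet-bounded functional with a smooth function. -/
def mulFun (P : Smooth E →ₗ[ℂ] ℂ) (g : Smooth E) : Smooth E →ₗ[ℂ] ℂ :=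
  P ∘ₗ LinearMap.mulLeft ℂ g

@[simp]
theorem mulFun_apply (P : Smooth E →ₗ[ℂ] ℂ) (g f : Smooth E) : mulFun P g f = P (g * f) := rfl

theorem JetBounded.mulFun {P : Smooth E →ₗ[ℂ] ℂ} (hP : JetBounded P) (g : Smooth E) :
    JetBounded (mulFun P g) := by
  obtain ⟨K, N, C, hK, h⟩ := hP
  obtain ⟨B, hB0, hB⟩ := Smooth.exists_jet_bound g hK N
  refine ⟨K, N, C * (2 ^ N * B), hK, fun f A hA hf => ?_⟩
  rw [mulFun_apply, mul_assoc]
  refine h _ _ (by positivity) fun k hk z hz => ?_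
  exact Smooth.norm_iteratedFDeriv_mul_le hA hB0 (fun k hk => hB k hk z hz)
    (fun k hk => hf k hk z hz) hk

/-- A real-linear form as a smooth function. -/
def linFun (ℓ : E →L[ℝ] ℂ) : Smooth E := ⟨ℓ, (ℓ.contDiff : ContDiff ℝ ∞ ℓ)⟩

/-- The exponential of a real-linear form. -/
def expFun (ℓ : E →L[ℝ] ℂ) : Smooth E :=
  ⟨fun z => Complex.exp (ℓ z), (ℓ.contDiff.cexp : ContDiff ℝ ∞ fun z => Complex.exp (ℓ z))⟩

@[simp] theorem linFun_apply (ℓ : E →L[ℝ] ℂ) (z : E) : (linFun ℓ : E → ℂ) z = ℓ z := rfl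

@[simp] theorem expFun_apply (ℓ : E →L[ℝ] ℂ) (z : E) :
    (expFun ℓ : E → ℂ) z = Complex.exp (ℓ z) := rfl

theorem expFun_add (ℓ ℓ' : E →L[ℝ] ℂ) : expFun (ℓ + ℓ') = expFun ℓ * expFun ℓ' := by
  ext z
  exact Complex.exp_add _ _

@[simp] theorem expFun_zero : expFun (0 : E →L[ℝ] ℂ) = 1 := by
  ext z
  exact Complex.exp_zero

theorem expFun_add_smul (s t : ℂ) (ℓ : E →L[ℝ] ℂ) :
    expFun ((s + t) • ℓ) = expFun (s • ℓ) * expFun (t • ℓ) := by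
  rw [← expFun_add]
  exact congrArg expFun (add_smul s t ℓ)

@[simp] theorem expFun_zero_smul (ℓ : E →L[ℝ] ℂ) : expFun ((0 : ℂ) • ℓ) = 1 :=
  (congrArg expFun (zero_smul ℂ ℓ)).trans expFun_zero

/-- The `k`-linear form `(m₁, …, m_k) ↦ ∏ ℓ(m_i)`. -/
def powForm (k : ℕ) (ℓ : E →L[ℝ] ℂ) : E [×k]→L[ℝ] ℂ :=
  (ContinuousMultilinearMap.mkPiAlgebra ℝ (Fin k) ℂ).compContinuousLinearMap fun _ => ℓ

theorem powForm_apply (k : ℕ) (ℓ : E →L[ℝ] ℂ) (m : Fin k → E) :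
    powForm k ℓ m = ∏ i, ℓ (m i) := rfl

theorem norm_powForm_le (k : ℕ) (ℓ : E →L[ℝ] ℂ) : ‖powForm k ℓ‖ ≤ ‖ℓ‖ ^ k := by
  refine (ContinuousMultilinearMap.norm_compContinuousLinearMap_le _ _).trans ?_
  simp

theorem continuous_powForm (k : ℕ) : Continuous (powForm k : (E →L[ℝ] ℂ) → E [×k]→L[ℝ] ℂ) :=
  ((ContinuousMultilinearMap.compContinuousLinearMapContinuousMultilinear ℝ (fun _ : Fin k => E)
    (fun _ : Fin k => ℂ) ℂ).cont.comp (continuous_pi fun _ => continuous_id)).clm_apply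
      continuous_const

theorem iteratedFDeriv_expFun (k : ℕ) (ℓ : E →L[ℝ] ℂ) :
    iteratedFDeriv ℝ k (expFun ℓ : E → ℂ) = fun z => Complex.exp (ℓ z) • powForm k ℓ := by
  induction k with
  | zero =>
    funext z
    ext m
    simp [powForm_apply]
  | succ k ih =>
    funext z
    ext m
    have hd : HasFDerivAt (fun z => Complex.exp (ℓ z)) (Complex.exp (ℓ z) • ℓ) z :=
      ℓ.hasFDerivAt.cexp
    rw [iteratedFDeriv_succ_apply_left, ih, (hd.smul_const (powForm k ℓ)).fderiv]
    simp only [ContinuousLinearMap.smulRight_apply, smul_apply,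
      powForm_apply, Fin.prod_univ_succ, smul_apply, smul_eq_mul, Fin.tail]
    ring

theorem norm_iteratedFDeriv_expFun_I_le (k : ℕ) (L : E →L[ℝ] ℂ) (hL : ∀ z, (L z).re = 0) (z : E) :
    ‖iteratedFDeriv ℝ k (expFun L : E → ℂ) z‖ ≤ ‖L‖ ^ k := by
  rw [iteratedFDeriv_expFun, norm_smul, Complex.norm_exp, hL, Real.exp_zero, one_mul]
  exact norm_powForm_le k L

/-- A jet-bounded functional grows polynomially along imaginary exponentials, with an exponent that
does not depend on the factor `g`. -/
theorem JetBounded.exists_norm_expFun_le {P : Smooth E →ₗ[ℂ] ℂ} (hP : JetBounded P) :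
    ∃ N : ℕ, ∀ g : Smooth E, ∃ C : ℝ, 0 ≤ C ∧ ∀ L : E →L[ℝ] ℂ, (∀ z, (L z).re = 0) →
      ‖P (g * expFun L)‖ ≤ C * (1 + ‖L‖) ^ N := by
  obtain ⟨K, N, C, hK, h⟩ := hP
  refine ⟨N, fun g => ?_⟩
  obtain ⟨B, hB0, hB⟩ := Smooth.exists_jet_bound g hK N
  refine ⟨|C| * (2 ^ N * B), by positivity, fun L hL => ?_⟩
  have := h (g * expFun L) (2 ^ N * B * (1 + ‖L‖) ^ N) (by positivity) fun k hk z hz => ?_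
  · refine this.trans ?_
    rw [mul_assoc |C|]
    exact mul_le_mul_of_nonneg_right (le_abs_self C) (by positivity)
  refine Smooth.norm_iteratedFDeriv_mul_le (by positivity) hB0 (fun k hk => hB k hk z hz)
    (fun k hk => ?_) hk
  refine (norm_iteratedFDeriv_expFun_I_le _ L hL z).trans ?_
  refine (pow_le_pow_left₀ (norm_nonneg _) (by linarith : ‖L‖ ≤ 1 + ‖L‖) _).trans ?_
  exact pow_le_pow_right₀ (by linarith [norm_nonneg L]) hk

/-- Bounds for all real derivatives of the Taylor remainder `exp t - 1 - t`; the exponent `2 - k` is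
`0` for `k ≥ 2`. -/
theorem exists_norm_iteratedFDeriv_exp_remainder_le (k : ℕ) :
    ∃ C : ℝ, 0 ≤ C ∧ ∀ t : ℂ, ‖t‖ ≤ 1 →
      ‖iteratedFDeriv ℝ k (fun t : ℂ => Complex.exp t - 1 - t) t‖ ≤ C * ‖t‖ ^ (2 - k) := by
  have hsm : ContDiff ℝ ∞ (fun t : ℂ => Complex.exp t - 1 - t) :=
    (Complex.contDiff_exp.sub contDiff_const).sub contDiff_id
  match k with
  | 0 =>
    refine ⟨1, zero_le_one, fun t ht => ?_⟩
    rw [norm_iteratedFDeriv_zero, one_mul]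
    exact Complex.norm_exp_sub_one_sub_id_le ht
  | 1 =>
    refine ⟨2, zero_le_two, fun t ht => ?_⟩
    rw [norm_iteratedFDeriv_one]
    have hd : HasDerivAt (fun t : ℂ => Complex.exp t - 1 - t) (Complex.exp t - 1) t :=
      ((Complex.hasDerivAt_exp t).sub_const 1).sub (hasDerivAt_id t)
    rw [hd.complexToReal_fderiv.fderiv]
    refine ContinuousLinearMap.opNorm_le_bound _ (by positivity) fun v => ?_
    simp only [smul_apply, smul_eq_mul, norm_mul,
      one_apply_eq_self]
    gcongr
    simpa using Complex.norm_exp_sub_one_le ht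
  | k + 2 =>
    obtain ⟨C, hC⟩ := (isCompact_closedBall (0 : ℂ) 1).exists_bound_of_continuousOn
      (hsm.continuous_iteratedFDeriv (m := k + 2)
        (WithTop.coe_le_coe.mpr le_top)).continuousOn
    refine ⟨|C|, abs_nonneg C, fun t ht => ?_⟩
    simpa using (hC t (by simpa using ht)).trans (le_abs_self C)

/-- The first-order expansion of `h ↦ P (exp (h ℓ))` at `0`. Near the compact set carrying `P`,
`exp (h ℓ) - 1 - h ℓ` is the composition of `h ℓ` with the Taylor remainder of `exp`; each
derivative lowers the power of `|t|` in the bound for the latter by one and contributes a factor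
`h`. -/
theorem JetBounded.norm_exp_remainder_le {P : Smooth E →ₗ[ℂ] ℂ} (hP : JetBounded P)
    (ℓ : E →L[ℝ] ℂ) : ∃ C : ℝ, ∃ δ > 0, ∀ h : ℂ, ‖h‖ ≤ δ →
      ‖P (expFun (h • ℓ) - 1 - h • linFun ℓ)‖ ≤ C * ‖h‖ ^ 2 := by
  obtain ⟨K, N, C, hK, hb⟩ := hP
  obtain ⟨R, hR⟩ := hK.exists_bound_of_continuousOn ℓ.continuous.continuousOn
  choose B hB0 hB using exists_norm_iteratedFDeriv_exp_remainder_le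
  set S := ∑ k ∈ Finset.range (N + 1), B k with hS
  have hS0 : 0 ≤ S := Finset.sum_nonneg fun _ _ => hB0 _
  set M := 1 + |R| + ‖ℓ‖ with hM
  have hM1 : 1 ≤ M := by have := abs_nonneg R; have := norm_nonneg ℓ; linarith
  refine ⟨C * (S * M ^ (N + 2)), 1 / M, by positivity, fun h hh => ?_⟩
  have hh' : ‖h‖ * M ≤ 1 := by rwa [le_div_iff₀ (by positivity)] at hh
  have hh1 : ‖h‖ ≤ 1 := by nlinarith [norm_nonneg h]
  rw [mul_assoc]
  refine hb _ _ (by positivity) fun k hk z hz => ?_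
  have hsm : ContDiff ℝ ∞ (fun t : ℂ => Complex.exp t - 1 - t) :=
    (Complex.contDiff_exp.sub contDiff_const).sub contDiff_id
  have heq : ((expFun (h • ℓ) - 1 - h • linFun ℓ : Smooth E) : E → ℂ)
      = (fun t : ℂ => Complex.exp t - 1 - t) ∘ (h • ℓ) := by
    funext z
    rfl
  have hz1 : ‖(h • ℓ) z‖ ≤ ‖h‖ * M := by
    rw [smul_apply, norm_smul]
    have := (hR z hz).trans (le_abs_self R)
    gcongr
    linarith [norm_nonneg ℓ]
  rw [heq, (h • ℓ).iteratedFDeriv_comp_right hsm z (mod_cast le_top)]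
  refine (ContinuousMultilinearMap.norm_compContinuousLinearMap_le _ _).trans ?_
  rw [Finset.prod_const, Finset.card_univ, Fintype.card_fin, norm_smul]
  have h1 : ‖h‖ * ‖ℓ‖ ≤ ‖h‖ * M := by
    gcongr
    linarith [abs_nonneg R]
  calc _ ≤ (B k * (‖h‖ * M) ^ (2 - k)) * (‖h‖ * M) ^ k := by
        have h0 := hB0 k
        have h2 := (hB k _ (hz1.trans hh')).trans
          (mul_le_mul_of_nonneg_left (pow_le_pow_left₀ (norm_nonneg _) hz1 (2 - k)) h0)
        gcongr
    _ = B k * (‖h‖ * M) ^ (2 - k + k) := by rw [mul_assoc, ← pow_add]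
    _ ≤ S * (‖h‖ * M) ^ 2 := by
        refine mul_le_mul ?_ (pow_le_pow_of_le_one (by positivity) hh' (by omega)) (by positivity)
          hS0
        exact Finset.single_le_sum (f := B) (fun _ _ => hB0 _) (Finset.mem_range.mpr (by omega))
    _ ≤ S * M ^ (N + 2) * ‖h‖ ^ 2 := by
        rw [mul_pow, mul_assoc, mul_comm (‖h‖ ^ 2)]
        gcongr
        omega

/-- A jet-bounded functional is holomorphic along complex one-parameter families of
exponentials. -/
theorem JetBounded.hasDerivAt_expFun {P : Smooth E →ₗ[ℂ] ℂ} (hP : JetBounded P)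
    (g : Smooth E) (ℓ : E →L[ℝ] ℂ) (s : ℂ) :
    HasDerivAt (fun s : ℂ => P (g * expFun (s • ℓ))) (P (g * linFun ℓ * expFun (s • ℓ))) s := by
  rw [hasDerivAt_iff_isLittleO_nhds_zero]
  obtain ⟨C, δ, hδ, h⟩ := (hP.mulFun (g * expFun (s • ℓ))).norm_exp_remainder_le ℓ
  refine Asymptotics.IsBigO.trans_isLittleO (g := fun h : ℂ => h ^ 2) ?_ ?_
  · refine Asymptotics.IsBigO.of_bound C ?_
    filter_upwards [Metric.closedBall_mem_nhds (0 : ℂ) hδ] with t ht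
    have ht' : ‖t‖ ≤ δ := by simpa using ht
    have := h t ht'
    rw [norm_pow]
    refine le_trans (le_of_eq ?_) this
    congr 1
    rw [mulFun_apply, ← map_smul P t, ← map_sub, ← map_sub]
    congr 1
    rw [expFun_add_smul]
    simp only [mul_sub, mul_one, mul_smul_comm]
    rw [← mul_assoc g, mul_right_comm g (linFun ℓ)]
  · exact Asymptotics.isLittleO_pow_id one_lt_two

theorem JetBounded.differentiable_expFun {P : Smooth E →ₗ[ℂ] ℂ} (hP : JetBounded P)
    (g : Smooth E) (ℓ : E →L[ℝ] ℂ) : Differentiable ℂ fun s : ℂ => P (g * expFun (s • ℓ)) :=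
  fun s => (hP.hasDerivAt_expFun g ℓ s).differentiableAt

/-- A jet-bounded functional vanishing on all powers of a linear form vanishes on its
exponential. -/
theorem JetBounded.map_expFun_eq_zero {P : Smooth E →ₗ[ℂ] ℂ} (hP : JetBounded P)
    (g : Smooth E) (ℓ : E →L[ℝ] ℂ) (h : ∀ n : ℕ, P (g * linFun ℓ ^ n) = 0) :
    P (g * expFun ℓ) = 0 := by
  have hder : ∀ n : ℕ, iteratedDeriv n (fun s : ℂ => P (g * expFun (s • ℓ)))
      = fun s => P (g * linFun ℓ ^ n * expFun (s • ℓ)) := by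
    intro n
    induction n with
    | zero => funext s; simp
    | succ n ih =>
      funext s
      rw [iteratedDeriv_succ, ih, (hP.hasDerivAt_expFun _ ℓ s).deriv]
      congr 2
      ring
  have hT := Complex.taylorSeries_eq_of_entire' (c := (0 : ℂ)) (z := 1)
    (hP.differentiable_expFun g ℓ)
  have h1 : P (g * expFun ((1 : ℂ) • ℓ)) = 0 := by
    rw [← hT]
    refine (tsum_congr fun n => ?_).trans tsum_zero
    rw [hder]
    simp [h]
  simpa using h1

end JetBounded

/-! ### Fourier inversion for functionals bounded by jets -/

section Density

open MeasureTheory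
open scoped FourierTransform

variable {E : Type*} [NormedAddCommGroup E] [NormedSpace ℝ E]

/-- A linear map has a linear section over its range. -/
theorem exists_linear_section {k V W : Type*} [Field k] [AddCommGroup V] [Module k V]
    [AddCommGroup W] [Module k W] (f : V →ₗ[k] W) :
    ∃ s : LinearMap.range f →ₗ[k] V, ∀ y, f (s y) = y := by
  obtain ⟨s, hs⟩ := f.rangeRestrict.exists_rightInverse_of_surjective
    (LinearMap.range_rangeRestrict _)
  exact ⟨s, fun y => congrArg Subtype.val (LinearMap.congr_fun hs y)⟩

/-- The Banach space of jets of order `N` on `K`: families of continuous functions on `K`, the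
`k`-th with values in the `k`-linear maps. No compatibility between the members is required. -/
def JetSpace (K : Compacts E) (N : ℕ) : Type _ :=
  ∀ k : Fin (N + 1), C(K, E [×(k : ℕ)]→L[ℝ] ℂ)

instance (K : Compacts E) (N : ℕ) : NormedAddCommGroup (JetSpace K N) :=
  inferInstanceAs (NormedAddCommGroup (∀ k : Fin (N + 1), C(K, E [×(k : ℕ)]→L[ℝ] ℂ)))

instance (K : Compacts E) (N : ℕ) : NormedSpace ℂ (JetSpace K N) :=
  inferInstanceAs (NormedSpace ℂ (∀ k : Fin (N + 1), C(K, E [×(k : ℕ)]→L[ℝ] ℂ)))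

instance (K : Compacts E) (N : ℕ) : CompleteSpace (JetSpace K N) :=
  inferInstanceAs (CompleteSpace (∀ k : Fin (N + 1), C(K, E [×(k : ℕ)]→L[ℝ] ℂ)))

/-- Evaluation of one derivative at one point, as a continuous functional of the jet. -/
def JetSpace.eval {K : Compacts E} {N : ℕ} (k : Fin (N + 1)) (z : K) :
    JetSpace K N →L[ℂ] E [×(k : ℕ)]→L[ℝ] ℂ :=
  (ContinuousMap.evalCLM ℂ z) ∘L
    (ContinuousLinearMap.proj (φ := fun k : Fin (N + 1) => C(K, E [×(k : ℕ)]→L[ℝ] ℂ)) k)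

/-- The jet of order `N` on `K` of a smooth function. -/
def jet (K : Compacts E) (N : ℕ) : Smooth E →ₗ[ℂ] JetSpace K N where
  toFun f k := ⟨fun z => iteratedFDeriv ℝ k (f : E → ℂ) z,
    ((Smooth.contDiff f).continuous_iteratedFDeriv (m := k) (mod_cast le_top)).comp
      continuous_subtype_val⟩
  map_add' f g := by
    funext k
    ext1 z
    exact congrFun (iteratedFDeriv_add ((Smooth.contDiff f).of_le (mod_cast le_top))
      ((Smooth.contDiff g).of_le (mod_cast le_top))) z.1
  map_smul' c f := by
    funext k
    ext1 z
    exact iteratedFDeriv_const_smul_apply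
      (((Smooth.contDiff f).of_le (mod_cast le_top)).contDiffAt)

theorem jet_apply (K : Compacts E) (N : ℕ) (f : Smooth E) (k : Fin (N + 1)) (z : K) :
    jet K N f k z = iteratedFDeriv ℝ k (f : E → ℂ) z := rfl

/-- A jet-bounded functional is a continuous linear functional of the jet (Hahn-Banach). -/
theorem JetBounded.exists_eq_comp_jet {P : Smooth E →ₗ[ℂ] ℂ} (hP : JetBounded P) :
    ∃ (K : Compacts E) (N : ℕ) (Λ : JetSpace K N →L[ℂ] ℂ),
      ∀ f, P f = Λ (jet K N f) := by
  obtain ⟨K₀, N, C, hK, hb⟩ := hP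
  let K : Compacts E := ⟨K₀, hK⟩
  have hb' : ∀ f, ‖P f‖ ≤ C * ‖jet K N f‖ := fun f =>
    hb f _ (norm_nonneg _) fun k hk z hz =>
      ((jet K N f ⟨k, by omega⟩).norm_coe_le_norm ⟨z, hz⟩).trans
        (norm_le_pi_norm (jet K N f) ⟨k, by omega⟩)
  obtain ⟨s, hs'⟩ := exists_linear_section (jet (E := E) K N)
  let φ : StrongDual ℂ (LinearMap.range (jet K N)) := (P ∘ₗ s).mkContinuous C fun y => by
    have := hb' (s y)
    rw [hs'] at this
    exact this
  obtain ⟨Λ, hΛ, -⟩ := exists_extension_norm_eq _ φ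
  refine ⟨K, N, Λ, fun f => ?_⟩
  have h1 := hΛ ⟨jet K N f, LinearMap.mem_range_self _ f⟩
  rw [h1]
  change P f = P (s _)
  have h2 : P (s ⟨jet K N f, LinearMap.mem_range_self _ f⟩ - f) = 0 := by
    have := hb' (s ⟨jet K N f, LinearMap.mem_range_self _ f⟩ - f)
    rw [map_sub (jet K N), hs', sub_self, norm_zero, mul_zero] at this
    exact norm_le_zero_iff.mp this
  rw [map_sub, sub_eq_zero] at h2
  exact h2.symm

theorem continuous_jet_expFun {V : Type*} [TopologicalSpace V] (K : Compacts E) (N : ℕ)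
    {ℓ : V → E →L[ℝ] ℂ} (hℓ : Continuous ℓ) : Continuous fun v => jet K N (expFun (ℓ v)) := by
  refine continuous_pi fun k => ?_
  have hc : Continuous fun p : V × K =>
      iteratedFDeriv ℝ (k : ℕ) (expFun (ℓ p.1) : E → ℂ) (p.2 : E) := by
    simp only [iteratedFDeriv_expFun]
    have h1 : Continuous fun p : V × K => ℓ p.1 (p.2 : E) :=
      (hℓ.comp continuous_fst).clm_apply (continuous_subtype_val.comp continuous_snd)
    exact h1.cexp.smul ((continuous_powForm k).comp (hℓ.comp continuous_fst))
  exact (ContinuousMap.curry ⟨_, hc⟩).continuous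

theorem norm_jet_expFun_le (K : Compacts E) (N : ℕ) (L : E →L[ℝ] ℂ)
    (hL : ∀ z, (L z).re = 0) : ‖jet K N (expFun L)‖ ≤ (1 + ‖L‖) ^ N := by
  refine (pi_norm_le_iff_of_nonneg (by positivity)).mpr fun k => ?_
  refine (ContinuousMap.norm_le _ (by positivity)).mpr fun z => ?_
  refine (norm_iteratedFDeriv_expFun_I_le _ L hL z).trans ?_
  refine (pow_le_pow_left₀ (norm_nonneg _) (by linarith : ‖L‖ ≤ 1 + ‖L‖) _).trans ?_
  exact pow_le_pow_right₀ (by linarith [norm_nonneg L]) (by omega)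

variable [FiniteDimensional ℝ E]

/-- A jet-bounded functional vanishing on all exponentials of linear forms vanishes on compactly
supported functions: by Fourier inversion, the jet of a compactly supported function is a convergent
integral of jets of imaginary exponentials. -/
theorem JetBounded.eq_zero_of_map_expFun {P : Smooth E →ₗ[ℂ] ℂ} (hP : JetBounded P)
    (h : ∀ L : E →L[ℝ] ℂ, P (expFun L) = 0) (f : Smooth E)
    (hf : HasCompactSupport (f : E → ℂ)) : P f = 0 := by
  obtain ⟨K, N, Λ, hΛ⟩ := hP.exists_eq_comp_jet
  -- the Fourier transform is available on a Euclidean space, to which `E` is isomorphic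
  set A := toEuclidean (E := E)
  have hfA : HasCompactSupport ((f : E → ℂ) ∘ A.symm) :=
    hf.comp_homeomorph A.symm.toHomeomorph
  set g := 𝓕⁻ (hfA.toSchwartzMap ((Smooth.contDiff f).comp A.symm.contDiff)) with hg
  let V := EuclideanSpace ℝ (Fin (Module.finrank ℝ E))
  let L : V →L[ℝ] E →L[ℝ] ℝ :=
    ((ContinuousLinearMap.compL ℝ E V ℝ).flip (A : E →L[ℝ] V)) ∘L (innerSL ℝ)
  let ℓ : V → E →L[ℝ] ℂ := fun v => ((-(2 * Real.pi * Complex.I) : ℂ) • Complex.ofRealCLM) ∘L L v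
  have hℓ : ∀ v z, ℓ v z = -(2 * Real.pi * Complex.I) * (L v z : ℂ) := fun v z => rfl
  have hL : ∀ v z, L v z = inner ℝ v (A z) := fun v z => rfl
  have hℓre : ∀ v z, (ℓ v z).re = 0 := fun v z => by
    rw [hℓ]; simp
  have hℓc : Continuous ℓ := by fun_prop
  have hℓn : ∀ v, ‖ℓ v‖ ≤ 2 * Real.pi * ‖L‖ * ‖v‖ := fun v => by
    refine ContinuousLinearMap.opNorm_le_bound _ (by positivity) fun z => ?_
    rw [hℓ, norm_mul, norm_neg, Complex.norm_real]
    have := L.le_opNorm₂ v z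
    have hpi : ‖(2 * Real.pi * Complex.I : ℂ)‖ = 2 * Real.pi := by
      simp [abs_of_pos Real.pi_pos]
    rw [hpi, mul_assoc (2 * Real.pi), mul_assoc (2 * Real.pi)]
    gcongr
  have hchar : ∀ v z, ((Real.fourierChar (-L v z) : Circle) : ℂ) = Complex.exp (ℓ v z) := by
    intro v z
    rw [Real.fourierChar_apply, hℓ]
    congr 1
    push_cast
    ring
  have hfF : (f : E → ℂ)
      = VectorFourier.fourierIntegral Real.fourierChar volume L.toLinearMap₁₂ g := by
    funext z
    have h1 : 𝓕 g (A z) = (f : E → ℂ) z := by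
      rw [hg, FourierTransform.fourier_fourierInv_eq]
      simp
    rw [← h1, SchwartzMap.fourier_coe]
    rfl
  have hDf : ∀ (k : ℕ) (z : E), iteratedFDeriv ℝ k (f : E → ℂ) z
      = ∫ v, g v • iteratedFDeriv ℝ k (expFun (ℓ v) : E → ℂ) z := by
    intro k z
    rw [hfF, VectorFourier.iteratedFDeriv_fourierIntegral (N := ⊤) L
      (fun n _ => g.integrable_pow_mul volume n) g.continuous.aestronglyMeasurable le_top]
    refine integral_congr_ae (Eventually.of_forall fun v => ?_)
    ext m
    change (Real.fourierChar (-L v z)) • (VectorFourier.fourierPowSMulRight L g v k m)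
      = (g v • iteratedFDeriv ℝ k (expFun (ℓ v) : E → ℂ) z) m
    rw [iteratedFDeriv_expFun, Circle.smul_def, hchar]
    simp only [smul_apply, VectorFourier.fourierPowSMulRight_apply, powForm_apply, hℓ,
      Finset.prod_mul_distrib, Finset.prod_const, Finset.card_univ, Fintype.card_fin, smul_eq_mul,
      Complex.real_smul, Complex.ofReal_prod]
    ring
  -- the integral of jets converges since `g` is rapidly decreasing
  let G : V → JetSpace K N := fun v => g v • jet K N (expFun (ℓ v))
  have hGc : Continuous G := g.continuous.smul (continuous_jet_expFun K N hℓc)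
  set c := 1 + 2 * Real.pi * ‖L‖ with hc
  have hc1 : 0 ≤ c := by positivity
  have hGi : Integrable G := by
    have hint : Integrable fun v => c ^ N * 2 ^ N * (‖g v‖ + ‖v‖ ^ N * ‖g v‖) :=
      (g.integrable.norm.add (g.integrable_pow_mul volume N)).const_mul _
    refine hint.mono' hGc.aestronglyMeasurable (Eventually.of_forall fun v => ?_)
    rw [norm_smul]
    have h1 := norm_jet_expFun_le K N (ℓ v) (hℓre v)
    have h2 : 1 + ‖ℓ v‖ ≤ c * (1 + ‖v‖) := by
      have := hℓn v
      rw [hc]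
      nlinarith [norm_nonneg v, norm_nonneg L, Real.pi_pos,
        mul_nonneg Real.pi_pos.le (norm_nonneg L)]
    have h3 : (1 + ‖v‖) ^ N ≤ 2 ^ N * (1 + ‖v‖ ^ N) := by
      refine (add_pow_le zero_le_one (norm_nonneg v) N).trans ?_
      rw [one_pow]
      gcongr
      · norm_num
      · omega
    calc ‖g v‖ * ‖jet K N (expFun (ℓ v))‖ ≤ ‖g v‖ * (c ^ N * (2 ^ N * (1 + ‖v‖ ^ N))) := by
          gcongr
          refine h1.trans ((pow_le_pow_left₀ (by positivity) h2 N).trans ?_)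
          rw [mul_pow]
          gcongr
      _ = _ := by ring
  have hJ : jet K N f = ∫ v, G v := by
    funext k
    ext1 z
    change _ = JetSpace.eval k z (∫ v, G v)
    rw [← (JetSpace.eval k z).integral_comp_comm hGi, jet_apply, hDf]
    rfl
  rw [hΛ, hJ, ← Λ.integral_comp_comm hGi]
  refine (integral_congr_ae (Eventually.of_forall fun v => ?_)).trans (integral_zero V ℂ)
  change Λ (g v • jet K N (expFun (ℓ v))) = 0
  rw [map_smul, ← hΛ, h, smul_zero]

end Density

/-! ### Functionals supported at finitely many points -/

section Flat

variable {E : Type*} [NormedAddCommGroup E] [NormedSpace ℝ E]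

/-- A smooth function is `n`-flat at `w` if its derivatives of order `< n` vanish at `w`. -/
def FlatAt (n : ℕ) (f : Smooth E) (w : E) : Prop :=
  ∀ k < n, iteratedFDeriv ℝ k (f : E → ℂ) w = 0

theorem FlatAt.mul {n m : ℕ} {f g : Smooth E} {w : E} (hf : FlatAt n f w) (hg : FlatAt m g w) :
    FlatAt (n + m) (f * g) w := by
  intro k hk
  rw [← norm_le_zero_iff]
  refine (norm_iteratedFDeriv_mul_le (Smooth.contDiff f) (Smooth.contDiff g) w
    (mod_cast le_top)).trans (Finset.sum_nonpos fun i hi => ?_)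
  have hi' := Finset.mem_range.mp hi
  rcases lt_or_ge i n with h | h
  · rw [hf i h, norm_zero, mul_zero, zero_mul]
  · rw [hg (k - i) (by omega), norm_zero, mul_zero]

theorem flatAt_zero (f : Smooth E) (w : E) : FlatAt 0 f w := fun _ hk => absurd hk (by omega)

theorem FlatAt.mul_left {n : ℕ} {g : Smooth E} {w : E} (f : Smooth E) (hg : FlatAt n g w) :
    FlatAt n (f * g) w := by
  simpa using (flatAt_zero f w).mul hg

theorem flatAt_one {f : Smooth E} {w : E} (h : (f : E → ℂ) w = 0) : FlatAt 1 f w := by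
  intro k hk
  obtain rfl : k = 0 := by omega
  ext m
  simpa using h

theorem FlatAt.pow {f : Smooth E} {w : E} (h : (f : E → ℂ) w = 0) (n : ℕ) : FlatAt n (f ^ n) w := by
  induction n with
  | zero => exact flatAt_zero _ _
  | succ n ih => rw [pow_succ]; exact ih.mul (flatAt_one h)

theorem FlatAt.of_eventually_eq_zero (n : ℕ) {f : Smooth E} {w : E}
    (h : ∀ᶠ z in 𝓝 w, (f : E → ℂ) z = 0) : FlatAt n f w := by
  intro k _
  have h' : (f : E → ℂ) =ᶠ[𝓝 w] fun _ => 0 := h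
  rw [(h'.iteratedFDeriv ℝ k).eq_of_nhds, iteratedFDeriv_fun_zero]
  rfl

theorem FlatAt.add {n : ℕ} {f g : Smooth E} {w : E} (hf : FlatAt n f w) (hg : FlatAt n g w) :
    FlatAt n (f + g) w := by
  intro k hk
  have := iteratedFDeriv_add_apply (𝕜 := ℝ) (i := k) (x := w)
    ((Smooth.contDiff f).contDiffAt.of_le (mod_cast le_top))
    ((Smooth.contDiff g).contDiffAt.of_le (mod_cast le_top))
  rw [hf k hk, hg k hk, add_zero] at this
  exact this

variable [FiniteDimensional ℝ E]

/-- Taylor estimate for the derivatives of a flat function: the derivative of order `n` is bounded,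
and each integration towards `w` gains a factor `‖z - w‖`. -/
theorem FlatAt.exists_norm_le {n : ℕ} {f : Smooth E} {w : E} (hf : FlatAt n f w) :
    ∃ A : ℝ, 0 ≤ A ∧ ∀ j ≤ n, ∀ z, ‖z - w‖ ≤ 1 →
      ‖iteratedFDeriv ℝ j (f : E → ℂ) z‖ ≤ A * ‖z - w‖ ^ (n - j) := by
  have key : ∀ i : ℕ, ∃ A : ℝ, 0 ≤ A ∧ ∀ j, i + j = n → ∀ z, ‖z - w‖ ≤ 1 →
      ‖iteratedFDeriv ℝ j (f : E → ℂ) z‖ ≤ A * ‖z - w‖ ^ i := by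
    intro i
    induction i with
    | zero =>
      obtain ⟨B, hB0, hB⟩ := Smooth.exists_jet_bound f (isCompact_closedBall w 1) n
      refine ⟨B, hB0, fun j hj z hz => ?_⟩
      simpa using hB j (by omega) z (by simpa [dist_eq_norm] using hz)
    | succ i ih =>
      obtain ⟨A, hA0, hA⟩ := ih
      refine ⟨A, hA0, fun j hj z hz => ?_⟩
      have h1 := (convex_closedBall w ‖z - w‖).norm_image_sub_le_of_norm_fderiv_le
        (𝕜 := ℝ) (f := iteratedFDeriv ℝ j (f : E → ℂ)) (C := A * ‖z - w‖ ^ i) (x := w) (y := z)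
        (fun x _ => ((Smooth.contDiff f).differentiable_iteratedFDeriv
          (WithTop.coe_lt_coe.mpr (ENat.natCast_lt_top j))) x)
        (fun x hx => ?_) (Metric.mem_closedBall_self (norm_nonneg _))
        (by simp [dist_eq_norm])
      · rw [hf j (by omega), sub_zero] at h1
        refine h1.trans (le_of_eq ?_)
        ring
      · have hx' : ‖x - w‖ ≤ ‖z - w‖ := by simpa [dist_eq_norm] using hx
        rw [norm_fderiv_iteratedFDeriv]
        refine (hA (j + 1) (by omega) x (hx'.trans hz)).trans ?_
        gcongr
  choose A hA0 hA using key
  refine ⟨∑ i ∈ Finset.range (n + 1), A i, Finset.sum_nonneg fun _ _ => hA0 _,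
    fun j hj z hz => (hA (n - j) j (by omega) z hz).trans ?_⟩
  gcongr
  exact Finset.single_le_sum (f := A) (fun _ _ => hA0 _) (Finset.mem_range.mpr (by omega))

/-- A fixed smooth cutoff function, equal to `1` on the unit ball and supported in the ball of
radius `2`. -/
def cutoffBase (E : Type*) [NormedAddCommGroup E] [NormedSpace ℝ E] [FiniteDimensional ℝ E] :
    ContDiffBump (0 : E) := ⟨1, 2, one_pos, one_lt_two⟩

/-- The cutoff function at scale `ε` around `w`. -/
def cutoffAt (w : E) (ε : ℝ) : Smooth E :=
  ⟨fun z => (cutoffBase E (ε⁻¹ • (z - w)) : ℂ),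
    (Complex.ofRealCLM.contDiff.comp ((cutoffBase E).contDiff.comp
      ((contDiff_id.sub contDiff_const).const_smul _)) :
      ContDiff ℝ ∞ fun z : E => (cutoffBase E (ε⁻¹ • (z - w)) : ℂ))⟩

theorem cutoffAt_apply (w : E) (ε : ℝ) (z : E) :
    (cutoffAt w ε : E → ℂ) z = (cutoffBase E (ε⁻¹ • (z - w)) : ℂ) := rfl

theorem cutoffAt_eq_one {w : E} {ε : ℝ} (hε : 0 < ε) {z : E} (hz : ‖z - w‖ ≤ ε) :
    (cutoffAt w ε : E → ℂ) z = 1 := by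
  rw [cutoffAt_apply, (cutoffBase E).one_of_mem_closedBall, Complex.ofReal_one]
  rw [mem_closedBall_zero_iff, norm_smul, norm_inv, Real.norm_of_nonneg hε.le]
  change ε⁻¹ * ‖z - w‖ ≤ 1
  rw [inv_mul_le_iff₀ hε]
  linarith

theorem cutoffAt_eq_zero {w : E} {ε : ℝ} (hε : 0 < ε) {z : E} (hz : 2 * ε ≤ ‖z - w‖) :
    (cutoffAt w ε : E → ℂ) z = 0 := by
  rw [cutoffAt_apply, (cutoffBase E).zero_of_le_dist, Complex.ofReal_zero]
  rw [dist_zero_right, norm_smul, norm_inv, Real.norm_of_nonneg hε.le]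
  change (2 : ℝ) ≤ ε⁻¹ * ‖z - w‖
  rw [le_inv_mul_iff₀ hε]
  linarith

theorem norm_iteratedFDeriv_cutoffAt (N : ℕ) : ∃ B : ℝ, 0 ≤ B ∧ ∀ (w : E) (ε : ℝ), 0 < ε →
    ∀ k ≤ N, ∀ z, ‖iteratedFDeriv ℝ k (cutoffAt w ε : E → ℂ) z‖ ≤ B * ε⁻¹ ^ k := by
  set β : Smooth E := cutoffAt 0 1
  have hsupp : HasCompactSupport (β : E → ℂ) := by
    refine HasCompactSupport.of_support_subset_isCompact (isCompact_closedBall (0 : E) 2) ?_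
    intro z hz
    by_contra hn
    refine hz (cutoffAt_eq_zero one_pos ?_)
    have : 2 < ‖z‖ := by simpa using hn
    simpa using this.le
  have h : ∀ k : ℕ, ∃ B : ℝ, ∀ z, ‖iteratedFDeriv ℝ k (β : E → ℂ) z‖ ≤ B := fun k =>
    (hsupp.iteratedFDeriv k).exists_bound_of_continuous
      ((Smooth.contDiff β).continuous_iteratedFDeriv (m := k) (mod_cast le_top))
  choose B hB using h
  refine ⟨∑ k ∈ Finset.range (N + 1), |B k|, Finset.sum_nonneg fun _ _ => abs_nonneg _, ?_⟩
  intro w ε hε k hk z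
  have heq : (cutoffAt w ε : E → ℂ)
      = fun z => ((β : E → ℂ) ∘ (ε⁻¹ • ContinuousLinearMap.id ℝ E)) (z - w) := by
    funext z
    simp [β, cutoffAt_apply]
  rw [heq, iteratedFDeriv_comp_sub, (ε⁻¹ • ContinuousLinearMap.id ℝ E).iteratedFDeriv_comp_right
    (Smooth.contDiff β) _ (mod_cast le_top)]
  refine (ContinuousMultilinearMap.norm_compContinuousLinearMap_le _ _).trans ?_
  rw [Finset.prod_const, Finset.card_univ, Fintype.card_fin]
  have h1 : ‖ε⁻¹ • ContinuousLinearMap.id ℝ E‖ ≤ ε⁻¹ := by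
    rw [norm_smul, norm_inv, Real.norm_of_nonneg hε.le]
    exact mul_le_of_le_one_right (by positivity) ContinuousLinearMap.norm_id_le
  gcongr
  refine (hB k _).trans ((le_abs_self _).trans ?_)
  exact Finset.single_le_sum (f := fun k => |B k|) (fun _ _ => abs_nonneg _)
    (Finset.mem_range.mpr (by omega))

/-- A jet-bounded functional of order `N` is `O(ε)` on an `(N+1)`-flat function cut off at scale
`ε`: a derivative of the cutoff costs a factor `ε⁻¹`, and one of the flat function a factor
`‖z - w‖⁻¹`, where `‖z - w‖ ≤ 2 ε`. -/
theorem JetBounded.exists_norm_cutoffAt_mul_le {P : Smooth E →ₗ[ℂ] ℂ} (hP : JetBounded P) :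
    ∃ n : ℕ, ∀ (f : Smooth E) (w : E), FlatAt n f w →
      ∃ C : ℝ, ∀ ε : ℝ, 0 < ε → ε ≤ 1 / 2 → ‖P (cutoffAt w ε * f)‖ ≤ C * ε := by
  obtain ⟨K, N, C, hK, hb⟩ := hP
  refine ⟨N + 1, fun f w hf => ?_⟩
  obtain ⟨A, hA0, hA⟩ := hf.exists_norm_le
  obtain ⟨B, hB0, hB⟩ := norm_iteratedFDeriv_cutoffAt (E := E) N
  refine ⟨C * (2 ^ N * (B * A * 2 ^ (N + 1))), fun ε hε hε' => ?_⟩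
  rw [mul_assoc]
  refine hb _ _ (by positivity) fun k hk z _ => ?_
  refine (norm_iteratedFDeriv_mul_le (Smooth.contDiff _) (Smooth.contDiff f) z
    (mod_cast le_top)).trans ?_
  have hterm : ∀ i ≤ k, ‖iteratedFDeriv ℝ i (cutoffAt w ε : E → ℂ) z‖
      * ‖iteratedFDeriv ℝ (k - i) (f : E → ℂ) z‖ ≤ B * A * 2 ^ (N + 1) * ε := by
    intro i hi
    rcases lt_or_ge (2 * ε) ‖z - w‖ with hz | hz
    · have : (cutoffAt w ε : E → ℂ) =ᶠ[𝓝 z] 0 := by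
        have hc : Continuous fun z : E => ‖z - w‖ := by fun_prop
        filter_upwards [hc.continuousAt.eventually_const_lt hz] with x hx
        exact cutoffAt_eq_zero hε hx.le
      rw [(this.iteratedFDeriv ℝ i).eq_of_nhds, Pi.zero_def, iteratedFDeriv_fun_zero]
      simp only [Pi.zero_apply, norm_zero, zero_mul]
      positivity
    · calc _ ≤ (B * ε⁻¹ ^ i) * (A * ‖z - w‖ ^ (N + 1 - (k - i))) := by
            gcongr
            · exact hB w ε hε i (by omega) z
            · exact hA _ (by omega) z (by linarith)
        _ ≤ (B * ε⁻¹ ^ i) * (A * (2 * ε) ^ (N + 1 - (k - i))) := by gcongr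
        _ = B * A * 2 ^ (N + 1 - (k - i)) * ε ^ (N + 1 - k) := by
            rw [mul_pow, show N + 1 - (k - i) = i + (N + 1 - k) by omega, pow_add ε, inv_pow]
            field_simp
        _ ≤ B * A * 2 ^ (N + 1) * ε := by
            gcongr
            · norm_num
            · omega
            · calc ε ^ (N + 1 - k) ≤ ε ^ 1 :=
                  pow_le_pow_of_le_one hε.le (by linarith) (by omega)
                _ = ε := pow_one ε
  calc ∑ i ∈ Finset.range (k + 1), (k.choose i : ℝ)
        * ‖iteratedFDeriv ℝ i (cutoffAt w ε : E → ℂ) z‖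
        * ‖iteratedFDeriv ℝ (k - i) (f : E → ℂ) z‖
      ≤ ∑ i ∈ Finset.range (k + 1), (k.choose i : ℝ) * (B * A * 2 ^ (N + 1) * ε) := by
        refine Finset.sum_le_sum fun i hi => ?_
        rw [mul_assoc]
        have := hterm i (by have := Finset.mem_range.mp hi; omega)
        gcongr
    _ = 2 ^ k * (B * A * 2 ^ (N + 1) * ε) := by
        rw [← Finset.sum_mul]
        norm_cast
        rw [Nat.sum_range_choose]
    _ ≤ 2 ^ N * (B * A * 2 ^ (N + 1) * ε) := by
        gcongr
        norm_num
    _ = _ := by ring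

/-- A jet-bounded functional supported in a finite set vanishes on functions that are sufficiently
flat at the points of this set. -/
theorem JetBounded.exists_eq_zero_of_flatAt {P : Smooth E →ₗ[ℂ] ℂ} (hP : JetBounded P)
    (Z : Finset E) (hloc : ∀ f : Smooth E, (∀ w ∈ Z, ∀ᶠ z in 𝓝 w, (f : E → ℂ) z = 0) → P f = 0) :
    ∃ n : ℕ, ∀ f : Smooth E, (∀ w ∈ Z, FlatAt n f w) → P f = 0 := by
  classical
  obtain ⟨n, hn⟩ := hP.exists_norm_cutoffAt_mul_le
  refine ⟨n, fun f hf => ?_⟩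
  have : ∀ w : E, ∃ C : ℝ, w ∈ Z → ∀ ε : ℝ, 0 < ε → ε ≤ 1 / 2 →
      ‖P (cutoffAt w ε * f)‖ ≤ C * ε := fun w => by
    by_cases hw : w ∈ Z
    · obtain ⟨C, hC⟩ := hn f w (hf w hw)
      exact ⟨C, fun _ => hC⟩
    · exact ⟨0, fun h => absurd h hw⟩
  choose C hC using this
  -- for small `ε` the cutoffs have disjoint supports, so that `f - ∑ χ_w f` vanishes near `Z`
  have hsep : ∀ᶠ ε in 𝓝[>] (0 : ℝ), ∀ w ∈ Z, ∀ w' ∈ Z, w ≠ w' → 3 * ε < ‖w - w'‖ := by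
    rw [Filter.eventually_all_finset]
    intro w _
    rw [Filter.eventually_all_finset]
    intro w' _
    by_cases hww : w = w'
    · exact Eventually.of_forall fun _ h => absurd hww h
    · have hpos : 0 < ‖w - w'‖ / 3 := by
        have := norm_pos_iff.mpr (sub_ne_zero.mpr hww)
        positivity
      filter_upwards [nhdsWithin_le_nhds (eventually_lt_nhds hpos)] with ε hε _
      linarith
  have hle : ∀ᶠ ε in 𝓝[>] (0 : ℝ), ‖P f‖ ≤ (∑ w ∈ Z, C w) * ε := by
    filter_upwards [hsep, self_mem_nhdsWithin,
      nhdsWithin_le_nhds (eventually_lt_nhds (show (0 : ℝ) < 1 / 2 by norm_num))] with ε hε hpos hlt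
    have hpos' : 0 < ε := hpos
    have h0 : P (f - ∑ w ∈ Z, cutoffAt w ε * f) = 0 := by
      refine hloc _ fun w hw => ?_
      filter_upwards [Metric.closedBall_mem_nhds w hpos'] with z hz
      have hz' : ‖z - w‖ ≤ ε := by simpa [dist_eq_norm] using hz
      have hsum : ((∑ w ∈ Z, cutoffAt w ε * f : Smooth E) : E → ℂ) z
          = ∑ w ∈ Z, (cutoffAt w ε : E → ℂ) z * (f : E → ℂ) z := by
        simp [Finset.sum_apply]
      change (f : E → ℂ) z - ((∑ w ∈ Z, cutoffAt w ε * f : Smooth E) : E → ℂ) z = 0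
      rw [hsum, Finset.sum_eq_single_of_mem w hw, cutoffAt_eq_one hpos' hz', one_mul, sub_self]
      intro w' hw' hne
      rw [cutoffAt_eq_zero hpos', zero_mul]
      have h3 := hε w hw w' hw' hne.symm
      have h4 : ‖w - w'‖ ≤ ‖z - w'‖ + ‖z - w‖ := by
        rw [show w - w' = (z - w') - (z - w) by abel]
        exact norm_sub_le _ _
      linarith
    rw [map_sub, sub_eq_zero] at h0
    rw [h0, map_sum, Finset.sum_mul]
    exact norm_sum_le_of_le _ fun w hw => hC w hw ε hpos' hlt.le
  have hlim : Tendsto (fun ε : ℝ => (∑ w ∈ Z, C w) * ε) (𝓝[>] 0) (𝓝 0) := by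
    have : Tendsto (fun ε : ℝ => (∑ w ∈ Z, C w) * ε) (𝓝 0) (𝓝 ((∑ w ∈ Z, C w) * 0)) :=
      (continuous_const.mul continuous_id).tendsto 0
    rw [mul_zero] at this
    exact this.mono_left nhdsWithin_le_nhds
  exact norm_le_zero_iff.mp (ge_of_tendsto hlim hle)

end Flat

/-! ### Minors of kernels and recurrent operators -/

section LinearAlgebra

/-- The square matrix of values of a kernel at two tuples of points. -/
def minor {X Y : Type*} (Φ : X → Y → ℂ) {ρ : ℕ} (x : Fin ρ → X) (y : Fin ρ → Y) :
    Matrix (Fin ρ) (Fin ρ) ℂ := Matrix.of fun i j => Φ (x i) (y j)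

@[simp] theorem minor_apply {X Y : Type*} (Φ : X → Y → ℂ) {ρ : ℕ} (x : Fin ρ → X) (y : Fin ρ → Y)
    (i j : Fin ρ) : minor Φ x y i j = Φ (x i) (y j) := rfl

/-- A kernel all of whose minors of size `r + 1` vanish is reproduced by a nonsingular minor of
size at most `r`. -/
theorem exists_minor_factorization {X Y : Type*} (Φ : X → Y → ℂ) (r : ℕ)
    (h : ∀ (x : Fin (r + 1) → X) (y : Fin (r + 1) → Y), (minor Φ x y).det = 0) :
    ∃ ρ ≤ r, ∃ (x₀ : Fin ρ → X) (y₀ : Fin ρ → Y), (minor Φ x₀ y₀).det ≠ 0 ∧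
      ∀ a b, Φ a b = ∑ j, ∑ i, Φ a (y₀ j) * (minor Φ x₀ y₀)⁻¹ j i * Φ (x₀ i) b := by
  classical
  have hex : ∃ ρ : ℕ, ∀ (x : Fin (ρ + 1) → X) (y : Fin (ρ + 1) → Y), (minor Φ x y).det = 0 :=
    ⟨r, h⟩
  set ρ := Nat.find hex with hρ
  have hz := Nat.find_spec hex
  have hne : ∃ (x₀ : Fin ρ → X) (y₀ : Fin ρ → Y), (minor Φ x₀ y₀).det ≠ 0 := by
    by_contra hcon
    push Not at hcon
    rcases Nat.eq_zero_or_pos ρ with h0 | hpos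
    · have h1 := hcon (fun i => (h0 ▸ i).elim0) (fun i => (h0 ▸ i).elim0)
      have : IsEmpty (Fin ρ) := by rw [h0]; infer_instance
      rw [Matrix.det_isEmpty] at h1
      exact one_ne_zero h1
    · obtain ⟨σ, hσ⟩ : ∃ σ, ρ = σ + 1 := ⟨ρ - 1, by omega⟩
      refine Nat.find_min hex (m := σ) (by omega) ?_
      rw [hσ] at hcon
      exact hcon
  obtain ⟨x₀, y₀, hdet⟩ := hne
  refine ⟨ρ, Nat.find_min' hex h, x₀, y₀, hdet, fun a b => ?_⟩
  set M := minor Φ x₀ y₀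
  let _ : Invertible M := Matrix.invertibleOfIsUnitDet M (isUnit_iff_ne_zero.mpr hdet)
  -- the bordered minor vanishes, and its Schur complement is the asserted identity
  have h1 := hz (Fin.append x₀ fun _ : Fin 1 => a) (Fin.append y₀ fun _ : Fin 1 => b)
  have h2 : (minor Φ (Fin.append x₀ fun _ : Fin 1 => a)
      (Fin.append y₀ fun _ : Fin 1 => b)).submatrix finSumFinEquiv finSumFinEquiv
      = Matrix.fromBlocks M (Matrix.of fun i (_ : Fin 1) => Φ (x₀ i) b)
        (Matrix.of fun (_ : Fin 1) j => Φ a (y₀ j)) (Matrix.of fun _ _ => Φ a b) := by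
    ext i j
    rcases i with i | i <;> rcases j with j | j <;> simp [M]
  rw [← Matrix.det_submatrix_equiv_self finSumFinEquiv, h2, Matrix.det_fromBlocks₁₁] at h1
  have h3 := (mul_eq_zero.mp h1).resolve_left hdet
  rw [Matrix.det_unique, Matrix.sub_apply, sub_eq_zero, Matrix.invOf_eq_nonsing_inv] at h3
  simp only [Matrix.of_apply, Matrix.mul_apply, Finset.sum_mul] at h3
  rw [h3, Finset.sum_comm]

/-- Minors of size larger than the number of summands of a separated kernel vanish. -/
theorem det_minor_eq_zero_of_factorization {X Y : Type*} {Φ : X → Y → ℂ} {ρ s : ℕ} (hs : ρ < s)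
    {u : X → Fin ρ → ℂ} {v : Fin ρ → Y → ℂ} (h : ∀ a b, Φ a b = ∑ j, u a j * v j b)
    (x : Fin s → X) (y : Fin s → Y) : (minor Φ x y).det = 0 := by
  by_contra hne
  have h1 : minor Φ x y = (Matrix.of fun i j => u (x i) j) * Matrix.of fun j i => v j (y i) := by
    ext i j
    simp [Matrix.mul_apply, h]
  have h2 := Matrix.rank_of_isUnit _
    ((Matrix.isUnit_iff_isUnit_det _).mpr (isUnit_iff_ne_zero.mpr hne))
  rw [h1] at h2
  have h3 := Matrix.rank_mul_le_left (Matrix.of fun i j => u (x i) j)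
    (Matrix.of fun j i => v j (y i))
  have h4 := Matrix.rank_le_width (Matrix.of fun i j => u (x i) j)
  rw [h2, Fintype.card_fin] at h3
  omega

/-- Minors of size larger than the rank of a possibly infinite matrix vanish. -/
theorem det_submatrix_eq_zero_of_eRank_le {X : Type*} {A : Matrix X X ℂ} {r : ℕ}
    (hA : A.eRank ≤ r) (x y : Fin (r + 1) → X) : (minor (fun a b => A a b) x y).det = 0 := by
  by_contra hne
  have h1 := (A.eRank_submatrix_le x y).trans hA
  have h2 : (A.submatrix x y).rank ≤ r := by
    rw [Matrix.rank_eq_finrank_span_cols, ← Matrix.eRank_toNat_eq_finrank]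
    exact ENat.toNat_le_of_le_natCast h1
  have h3 := Matrix.rank_of_isUnit (A.submatrix x y)
    ((Matrix.isUnit_iff_isUnit_det _).mpr (isUnit_iff_ne_zero.mpr hne))
  rw [h3, Fintype.card_fin] at h2
  omega

/-- If an operator satisfies `τ^m V ⊆ ∑_{l < m} τ^l V` for a finite-dimensional subspace `V`, then
some monic polynomial in `τ` annihilates `V`: the sum on the right is invariant under `τ` and
finite-dimensional. -/
theorem exists_monic_annihilating {k M : Type*} [Field k] [AddCommGroup M] [Module k M]
    (τ : Module.End k M) (V : Submodule k M) [FiniteDimensional k V] (m : ℕ) (hm : 0 < m)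
    (h : V.map (τ ^ m) ≤ ⨆ l : Fin m, V.map (τ ^ (l : ℕ))) :
    ∃ p : Polynomial k, p.Monic ∧ ∀ f ∈ V, Polynomial.aeval τ p f = 0 := by
  set W := ⨆ l : Fin m, V.map (τ ^ (l : ℕ)) with hW
  have hVW : V ≤ W := by
    refine le_trans (le_of_eq ?_) (le_iSup (fun l : Fin m => V.map (τ ^ (l : ℕ))) ⟨0, hm⟩)
    simp [Module.End.one_eq_id]
  have hinv : ∀ w ∈ W, τ w ∈ W := by
    have : W.map τ ≤ W := by
      rw [hW, Submodule.map_iSup]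
      refine iSup_le fun l => ?_
      rw [← Submodule.map_comp, ← Module.End.mul_eq_comp, ← pow_succ']
      rcases Nat.lt_or_ge (l + 1) m with hl | hl
      · exact le_iSup (fun l : Fin m => V.map (τ ^ (l : ℕ))) ⟨l + 1, hl⟩
      · have : (l : ℕ) + 1 = m := by omega
        rw [this]
        exact h
    intro w hw
    exact this (Submodule.mem_map_of_mem hw)
  have : FiniteDimensional k W := by rw [hW]; infer_instance
  obtain ⟨p, hp, hp0⟩ := LinearMap.exists_monic_and_aeval_eq_zero k (τ.restrict hinv)
  refine ⟨p, hp, fun f hf => ?_⟩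
  have key : ∀ (q : Polynomial k) (w : W),
      ((Polynomial.aeval (τ.restrict hinv) q w : W) : M) = Polynomial.aeval τ q (w : M) := by
    have hpow : ∀ (n : ℕ) (w : W), (((τ.restrict hinv) ^ n) w : M) = (τ ^ n) (w : M) := by
      intro n
      induction n with
      | zero => intro w; rfl
      | succ n ih => intro w; rw [pow_succ, pow_succ]; exact ih _
    intro q w
    simp [Polynomial.aeval_eq_sum_range, LinearMap.sum_apply, hpow]
  have := key p ⟨f, hVW hf⟩
  rw [hp0] at this
  exact this.symm

end LinearAlgebra

/-! ### Entire functions of polynomial growth -/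

section Entire

/-- The iterated difference of order `n + 1` of an entire function bounded by `C (1 + |s|)^n`
vanishes, because the function is a polynomial of degree at most `n` by Cauchy's estimates. -/
theorem sum_choose_mul_eq_zero_of_growth {f : ℂ → ℂ} (hf : Differentiable ℂ f) {n : ℕ} {C : ℝ}
    (hC : ∀ s, ‖f s‖ ≤ C * (1 + ‖s‖) ^ n) (c : ℂ) :
    ∑ l ∈ Finset.range (n + 1 + 1), (-1) ^ (n + 1 - l) * ((n + 1).choose l : ℂ) * f (l * c)
      = 0 := by
  have hC0 : 0 ≤ C := by
    have := (norm_nonneg _).trans (hC 0)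
    simpa using this
  have hcoef : ∀ k, n < k → iteratedDeriv k f 0 = 0 := by
    intro k hk
    have hb : ∀ R : ℝ, 1 ≤ R → ‖iteratedDeriv k f 0‖ ≤ k.factorial * (C * 2 ^ n) * R⁻¹ := by
      intro R hR
      have hR0 : 0 < R := by linarith
      refine (Complex.norm_iteratedDeriv_le_of_forall_mem_sphere_norm_le k hR0 hf.diffContOnCl
        (C := C * (2 * R) ^ n) fun z hz => ?_).trans ?_
      · refine (hC z).trans ?_
        have : ‖z‖ = R := by simpa using hz
        rw [this]
        gcongr
        linarith
      · obtain ⟨j, rfl⟩ : ∃ j, k = n + 1 + j := ⟨k - (n + 1), by omega⟩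
        have hRj : 1 ≤ R ^ j := one_le_pow₀ hR
        rw [div_le_iff₀ (by positivity), mul_pow]
        have : (n + 1 + j).factorial * (C * 2 ^ n) * R⁻¹ * R ^ (n + 1 + j)
            = (n + 1 + j).factorial * (C * (2 ^ n * R ^ n)) * R ^ j := by
          rw [pow_add, pow_add]
          field_simp
        rw [this]
        exact le_mul_of_one_le_right (by positivity) hRj
    have hlim : Tendsto (fun R : ℝ => k.factorial * (C * 2 ^ n) * R⁻¹) atTop (𝓝 0) := by
      simpa using tendsto_inv_atTop_zero.const_mul ((k.factorial : ℝ) * (C * 2 ^ n))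
    exact norm_le_zero_iff.mp (ge_of_tendsto hlim ((eventually_ge_atTop 1).mono hb))
  have hpoly : ∀ z, f z = ∑ k ∈ Finset.range (n + 1),
      ((k.factorial : ℂ)⁻¹ * iteratedDeriv k f 0) * z ^ k := by
    intro z
    rw [← Complex.taylorSeries_eq_of_entire' 0 z hf, tsum_eq_sum (s := Finset.range (n + 1))]
    · simp
    · intro k hk
      rw [hcoef k (by simpa using hk)]
      simp
  have h1 := fwdDiff_iter_sum_mul_pow_eq_zero
    (fun k => ((k.factorial : ℂ)⁻¹ * iteratedDeriv k f 0) * c ^ k) (n := n + 1)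
  have h2 := fwdDiff_iter_eq_sum_shift (1 : ℂ) (fun z => f (z * c)) (n + 1) 0
  have h3 : (fun z => f (z * c)) = fun r : ℂ => ∑ k ∈ Finset.range (n + 1),
      ((k.factorial : ℂ)⁻¹ * iteratedDeriv k f 0) * c ^ k * r ^ k := by
    funext z
    rw [hpoly]
    refine Finset.sum_congr rfl fun k _ => ?_
    rw [mul_pow]
    ring
  rw [h3, h1] at h2
  have h4 := h2.symm
  simp only [zero_add, nsmul_eq_mul, mul_one, zsmul_eq_mul] at h4
  push_cast at h4
  simpa using h4

end Entire

/-! ### Moments and the Fourier-Laplace transform -/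

section Exponentials

variable {d : ℕ}

/-- The real-linear form `z ↦ ∑ a_i z_i + ∑ b_i z̄_i`. -/
def form (a b : Fin d → ℂ) : (Fin d → ℂ) →L[ℝ] ℂ :=
  LinearMap.toContinuousLinearMap
    { toFun := fun z => ∑ i, a i * z i + ∑ i, b i * conj (z i)
      map_add' := fun z w => by
        simp only [Pi.add_apply, map_add, mul_add, Finset.sum_add_distrib]
        ring
      map_smul' := fun c z => by
        simp only [Pi.smul_apply, Complex.real_smul, map_mul, Complex.conj_ofReal,
          RingHom.id_apply, mul_add, Finset.mul_sum]
        congr 1 <;> exact Finset.sum_congr rfl fun i _ => by ring }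

theorem form_apply (a b z : Fin d → ℂ) :
    form a b z = ∑ i, a i * z i + ∑ i, b i * conj (z i) := rfl

theorem form_add (a a' b b' : Fin d → ℂ) : form (a + a') (b + b') = form a b + form a' b' := by
  ext z
  rw [add_apply]
  simp only [form_apply, Pi.add_apply, add_mul, Finset.sum_add_distrib]
  ring

theorem form_smul (s : ℂ) (a b : Fin d → ℂ) : form (s • a) (s • b) = s • form a b := by
  ext z
  rw [smul_apply]
  simp only [form_apply, Pi.smul_apply, smul_eq_mul, mul_add, Finset.mul_sum, mul_assoc]

/-- Every real-linear form on `ℂ^d` is the sum of a complex-linear and an antilinear form. -/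
theorem exists_eq_form (L : (Fin d → ℂ) →L[ℝ] ℂ) : ∃ a b, L = form a b := by
  let u : Fin d → ℂ := fun i => L (Pi.single i 1)
  let v : Fin d → ℂ := fun i => L (Pi.single i Complex.I)
  refine ⟨fun i => (u i - Complex.I * v i) / 2, fun i => (u i + Complex.I * v i) / 2, ?_⟩
  ext z
  have hz : z = ∑ i, ((z i).re • (Pi.single i (1 : ℂ) : Fin d → ℂ) +
      (z i).im • (Pi.single i Complex.I : Fin d → ℂ)) := by
    funext j
    simp only [Finset.sum_apply, Pi.add_apply, Pi.smul_apply, Pi.single_apply]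
    rw [Finset.sum_eq_single j (fun i _ hi => by simp [hi.symm]) (by simp)]
    simp only [if_true, Complex.real_smul, mul_one]
    exact (Complex.re_add_im (z j)).symm
  conv_lhs => rw [hz]
  rw [map_sum, form_apply, ← Finset.sum_add_distrib]
  refine Finset.sum_congr rfl fun i _ => ?_
  rw [map_add, map_smul, map_smul, Complex.real_smul, Complex.real_smul]
  conv_rhs => rw [← Complex.re_add_im (z i)]
  simp only [map_add, map_mul, Complex.conj_ofReal, Complex.conj_I]
  change ((z i).re : ℂ) * u i + ((z i).im : ℂ) * v i = _
  linear_combination ((z i).im : ℂ) * v i * Complex.I_mul_I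

/-- The exponential `z ↦ exp (a · z + b · z̄)`. -/
def expo (a b : Fin d → ℂ) : Smooth (Fin d → ℂ) := expFun (form a b)

theorem expo_add (a a' b b' : Fin d → ℂ) : expo (a + a') (b + b') = expo a b * expo a' b' := by
  rw [expo, form_add, expFun_add]
  rfl

theorem expo_zero : expo (0 : Fin d → ℂ) 0 = 1 := by
  ext z
  simp [expo, form_apply]

/-- The coordinate function `z_i`. -/
def coord (i : Fin d) : Smooth (Fin d → ℂ) :=
  ⟨fun z => z i, (contDiff_apply ℝ ℂ i : ContDiff ℝ ∞ fun z : Fin d → ℂ => z i)⟩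

/-- The conjugate coordinate function `z̄_i`. -/
def conjCoord (i : Fin d) : Smooth (Fin d → ℂ) :=
  ⟨fun z => conj (z i), (Complex.conjCLE.contDiff.comp (contDiff_apply ℝ ℂ i) :
    ContDiff ℝ ∞ fun z : Fin d → ℂ => conj (z i))⟩

/-- Holomorphic polynomials as smooth functions. -/
def hol : MvPolynomial (Fin d) ℂ →ₐ[ℂ] Smooth (Fin d → ℂ) := MvPolynomial.aeval coord

/-- Polynomials in the conjugate coordinates as smooth functions. -/
def anti : MvPolynomial (Fin d) ℂ →ₐ[ℂ] Smooth (Fin d → ℂ) := MvPolynomial.aeval conjCoord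

/-- The monomial with exponents `α`. -/
def mono (α : Fin d → ℕ) : MvPolynomial (Fin d) ℂ := ∏ i, MvPolynomial.X i ^ α i

theorem linearMap_ext_mono {V : Type*} [AddCommGroup V] [Module ℂ V]
    {f g : MvPolynomial (Fin d) ℂ →ₗ[ℂ] V} (h : ∀ α, f (mono α) = g (mono α)) : f = g := by
  refine LinearMap.ext fun p => ?_
  induction p using MvPolynomial.induction_on' with
  | monomial u a =>
    have : MvPolynomial.monomial u a = a • mono (d := d) u := by
      rw [MvPolynomial.monomial_eq, MvPolynomial.smul_eq_C_mul, mono,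
        Finsupp.prod_fintype _ _ fun i => pow_zero _]
    rw [this, map_smul, map_smul, h]
  | add p q hp hq => rw [map_add, map_add, hp, hq]

/-- The moment form `(p, q) ↦ ⟨P, p(z) q(z̄)⟩`. It is bilinear: `q(z̄)` is the polynomial `q`
evaluated at the conjugate coordinates, with the coefficients of `q` unchanged. -/
def polyForm (P : Smooth (Fin d → ℂ) →ₗ[ℂ] ℂ) :
    MvPolynomial (Fin d) ℂ →ₗ[ℂ] MvPolynomial (Fin d) ℂ →ₗ[ℂ] ℂ :=
  LinearMap.mk₂ ℂ (fun p q => P (hol p * anti q))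
    (fun p p' q => by rw [map_add, add_mul, map_add])
    (fun c p q => by rw [map_smul, smul_mul_assoc, map_smul])
    (fun p q q' => by rw [map_add, mul_add, map_add])
    (fun c p q => by rw [map_smul, mul_smul_comm, map_smul])

theorem polyForm_apply (P : Smooth (Fin d → ℂ) →ₗ[ℂ] ℂ) (p q : MvPolynomial (Fin d) ℂ) :
    polyForm P p q = P (hol p * anti q) := rfl

/-- The moment matrix of `P` has rank at most `r`, in the sense that all its minors of size `r + 1`
vanish. -/
def MomentRankLE (r : ℕ) (P : Smooth (Fin d → ℂ) →ₗ[ℂ] ℂ) : Prop :=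
  ∀ x y : Fin (r + 1) → (Fin d → ℕ),
    (minor (fun α β => polyForm P (mono α) (mono β)) x y).det = 0

/-- A moment matrix of rank at most `r` factors the form on all polynomials through finitely many
monomials. -/
theorem MomentRankLE.exists_factorization {r : ℕ} {P : Smooth (Fin d → ℂ) →ₗ[ℂ] ℂ}
    (h : MomentRankLE r P) : ∃ ρ ≤ r, ∃ (α β : Fin ρ → (Fin d → ℕ)) (N : Fin ρ → Fin ρ → ℂ),
      ∀ p q, polyForm P p q = ∑ j, ∑ i,
        polyForm P p (mono (β j)) * N j i * polyForm P (mono (α i)) q := by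
  obtain ⟨ρ, hρ, α, β, -, hfac⟩ := exists_minor_factorization _ r h
  refine ⟨ρ, hρ, α, β,
    fun j i => (minor (fun α β => polyForm P (mono α) (mono β)) α β)⁻¹ j i, fun p q => ?_⟩
  set N := (minor (fun α β => polyForm P (mono α) (mono β)) α β)⁻¹
  have h1 : ∀ (γ : Fin d → ℕ), (polyForm P).flip (mono γ) = ∑ j, ∑ i,
      (N j i * polyForm P (mono (α i)) (mono γ)) • (polyForm P).flip (mono (β j)) := by
    intro γ
    refine linearMap_ext_mono fun δ => ?_
    rw [LinearMap.flip_apply, hfac δ γ]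
    simp only [LinearMap.sum_apply, LinearMap.smul_apply, LinearMap.flip_apply, smul_eq_mul]
    exact Finset.sum_congr rfl fun j _ => Finset.sum_congr rfl fun i _ => by ring
  have h2 : polyForm P p = ∑ j, ∑ i,
      (polyForm P p (mono (β j)) * N j i) • polyForm P (mono (α i)) := by
    refine linearMap_ext_mono fun δ => ?_
    rw [← LinearMap.flip_apply, h1 δ]
    simp only [LinearMap.sum_apply, LinearMap.smul_apply, LinearMap.flip_apply, smul_eq_mul]
    exact Finset.sum_congr rfl fun j _ => Finset.sum_congr rfl fun i _ => by ring
  conv_lhs => rw [h2]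
  simp only [LinearMap.sum_apply, LinearMap.smul_apply, smul_eq_mul]

theorem linFun_form_left (a : Fin d → ℂ) :
    linFun (form a 0) = hol (∑ i, a i • MvPolynomial.X i) := by
  ext z
  rw [map_sum]
  simp [form_apply, hol, coord, Finset.sum_apply]

theorem linFun_form_right (b : Fin d → ℂ) :
    linFun (form 0 b) = anti (∑ i, b i • MvPolynomial.X i) := by
  ext z
  rw [map_sum]
  simp [form_apply, anti, conjCoord, Finset.sum_apply]

/-- A functional annihilating all holomorphic polynomials annihilates `exp (a · z)`. -/
theorem JetBounded.map_expo_left_eq_zero {P : Smooth (Fin d → ℂ) →ₗ[ℂ] ℂ} (hP : JetBounded P)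
    (g : Smooth (Fin d → ℂ)) (h : ∀ p, P (g * hol p) = 0) (a : Fin d → ℂ) :
    P (g * expo a 0) = 0 :=
  hP.map_expFun_eq_zero g (form a 0) fun n => by rw [linFun_form_left, ← map_pow, h]

theorem JetBounded.map_expo_right_eq_zero {P : Smooth (Fin d → ℂ) →ₗ[ℂ] ℂ} (hP : JetBounded P)
    (g : Smooth (Fin d → ℂ)) (h : ∀ q, P (g * anti q) = 0) (b : Fin d → ℂ) :
    P (g * expo 0 b) = 0 :=
  hP.map_expFun_eq_zero g (form 0 b) fun n => by rw [linFun_form_right, ← map_pow, h]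

/-- The kernel `(a, b) ↦ ⟨P, exp (a · z + b · z̄)⟩`: the Fourier-Laplace transform of `P`. -/
def laplace (P : Smooth (Fin d → ℂ) →ₗ[ℂ] ℂ) (a b : Fin d → ℂ) : ℂ := P (expo a b)

/-- The minors of the Fourier-Laplace transform vanish together with the moment minors: the
factorization of the moment form extends from polynomials to exponentials in each variable. -/
theorem MomentRankLE.det_minor_laplace {r : ℕ} {P : Smooth (Fin d → ℂ) →ₗ[ℂ] ℂ}
    (h : MomentRankLE r P) (hP : JetBounded P) (x y : Fin (r + 1) → (Fin d → ℂ)) :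
    (minor (laplace P) x y).det = 0 := by
  obtain ⟨ρ, hρ, α, β, N, hfac⟩ := h.exists_factorization
  have h1 : ∀ a q, P (expo a 0 * anti q) = ∑ j, ∑ i, P (expo a 0 * anti (mono (β j))) * N j i
      * P (hol (mono (α i)) * anti q) := by
    intro a q
    have := hP.map_expo_left_eq_zero (anti q - ∑ j, ∑ i,
      (N j i * P (hol (mono (α i)) * anti q)) • anti (mono (β j))) (fun p => ?_) a
    · rw [mul_comm] at this
      simp only [mul_sub, Finset.mul_sum, mul_smul_comm, map_sub, map_sum, map_smul, smul_eq_mul,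
        sub_eq_zero] at this
      rw [this]
      exact Finset.sum_congr rfl fun j _ => Finset.sum_congr rfl fun i _ => by ring
    · rw [mul_comm]
      simp only [mul_sub, Finset.mul_sum, mul_smul_comm, map_sub, map_sum, map_smul, smul_eq_mul,
        sub_eq_zero]
      have := hfac p q
      simp only [polyForm_apply] at this
      rw [this]
      exact Finset.sum_congr rfl fun j _ => Finset.sum_congr rfl fun i _ => by ring
  have h2 : ∀ a b, laplace P a b = ∑ j, ∑ i, P (expo a 0 * anti (mono (β j))) * N j i
      * P (hol (mono (α i)) * expo 0 b) := by
    intro a b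
    have := hP.map_expo_right_eq_zero (expo a 0 - ∑ j, ∑ i,
      (P (expo a 0 * anti (mono (β j))) * N j i) • hol (mono (α i))) (fun q => ?_) b
    · simp only [sub_mul, Finset.sum_mul, smul_mul_assoc, map_sub, map_sum, map_smul, smul_eq_mul,
        sub_eq_zero] at this
      rw [← this, laplace, ← expo_add, add_zero, zero_add]
    · simp only [sub_mul, Finset.sum_mul, smul_mul_assoc, map_sub, map_sum, map_smul, smul_eq_mul,
        sub_eq_zero]
      exact h1 a q
  refine det_minor_eq_zero_of_factorization (Nat.lt_succ_of_le hρ)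
    (u := fun a j => P (expo a 0 * anti (mono (β j))))
    (v := fun j b => ∑ i, N j i * P (hol (mono (α i)) * expo 0 b)) (fun a b => ?_) x y
  rw [h2]
  simp only [Finset.mul_sum, mul_assoc]

/-- A jet-bounded functional on `ℂ^d` multiplied by `g` is determined on compactly supported
functions by its moments against exponentials. -/
theorem JetBounded.mul_eq_zero_of_expo {P : Smooth (Fin d → ℂ) →ₗ[ℂ] ℂ} (hP : JetBounded P)
    (g : Smooth (Fin d → ℂ)) (h : ∀ a b, P (g * expo a b) = 0) (f : Smooth (Fin d → ℂ))
    (hf : HasCompactSupport (f : (Fin d → ℂ) → ℂ)) : P (g * f) = 0 := by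
  refine (hP.mulFun g).eq_zero_of_map_expFun (fun L => ?_) f hf
  obtain ⟨a, b, rfl⟩ := exists_eq_form L
  exact h a b

/-- A jet-bounded functional multiplied by `g` is determined on compactly supported functions by its
moments. -/
theorem JetBounded.mul_eq_zero_of_moments {P : Smooth (Fin d → ℂ) →ₗ[ℂ] ℂ} (hP : JetBounded P)
    (g : Smooth (Fin d → ℂ)) (h : ∀ α β, P (g * (hol (mono α) * anti (mono β))) = 0)
    (f : Smooth (Fin d → ℂ)) (hf : HasCompactSupport (f : (Fin d → ℂ) → ℂ)) : P (g * f) = 0 := by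
  have h1 : polyForm (FiniteRank.mulFun P g) = 0 := by
    refine linearMap_ext_mono fun α => linearMap_ext_mono fun β => ?_
    exact h α β
  have h2 : ∀ p q, P (g * (hol p * anti q)) = 0 := fun p q => by
    have := congrArg (fun B => B p q) h1
    exact this
  refine hP.mul_eq_zero_of_expo g (fun a b => ?_) f hf
  have h3 : ∀ q, P (g * expo a 0 * anti q) = 0 := fun q => by
    rw [mul_right_comm]
    refine hP.map_expo_left_eq_zero (g * anti q) (fun p => ?_) a
    rw [mul_assoc, mul_comm (anti q)]
    exact h2 p q
  have := hP.map_expo_right_eq_zero (g * expo a 0) h3 b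
  rwa [mul_assoc, ← expo_add, add_zero, zero_add] at this

end Exponentials

/-! ### Recurrences for kernels of finite rank -/

section Recurrence

theorem differentiable_det {n : ℕ} {M : ℂ → Matrix (Fin n) (Fin n) ℂ}
    (h : ∀ i j, Differentiable ℂ fun s => M s i j) : Differentiable ℂ fun s => (M s).det := by
  simp only [Matrix.det_apply]
  refine Differentiable.fun_sum fun σ _ => Differentiable.const_smul ?_ _
  exact Differentiable.fun_finsetProd fun i _ => h _ _

/-- Determinants of matrices whose entries grow at most like `|s|^N` grow at most like
`|s|^(N n)`. -/
theorem exists_norm_det_le {n N : ℕ} {M : ℂ → Matrix (Fin n) (Fin n) ℂ}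
    (h : ∀ i j, ∃ C : ℝ, ∀ s, ‖M s i j‖ ≤ C * (1 + ‖s‖) ^ N) :
    ∃ C : ℝ, ∀ s, ‖(M s).det‖ ≤ C * (1 + ‖s‖) ^ (N * n) := by
  choose C hC using h
  refine ⟨∑ σ : Equiv.Perm (Fin n), ∏ i, C (σ i) i, fun s => ?_⟩
  rw [Matrix.det_apply', Finset.sum_mul]
  refine (norm_sum_le _ _).trans (Finset.sum_le_sum fun σ _ => ?_)
  rw [norm_mul, norm_prod]
  have h1 : ‖((Equiv.Perm.sign σ : ℤ) : ℂ)‖ = 1 := by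
    rcases Int.units_eq_one_or (Equiv.Perm.sign σ) with h | h <;> simp [h]
  rw [h1, one_mul]
  refine (Finset.prod_le_prod (fun _ _ => norm_nonneg _) fun i _ => hC (σ i) i s).trans ?_
  rw [Finset.prod_mul_distrib, Finset.prod_const, Finset.card_univ, Fintype.card_fin, pow_mul]

/-- A minor as a function of one of its points is a combination of sections of the kernel, with
cofactors as coefficients. -/
theorem det_minor_update {X Y : Type*} (Φ : X → Y → ℂ) {ρ : ℕ} (x : Fin ρ → X) (y : Fin ρ → Y)
    (i : Fin ρ) (a : X) :
    (minor Φ (Function.update x i a) y).det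
      = Matrix.cramer (minor Φ x y).transpose (fun j => Φ a (y j)) i := by
  rw [Matrix.cramer_transpose_apply]
  congr 1
  ext k j
  rcases eq_or_ne k i with rfl | h
  · simp
  · simp [h]

variable {A : Type*} [AddCommGroup A] [Module ℂ A]

/-- Let `Φ` be a kernel of finite rank, entire along the direction `v` in each variable and of
polynomial growth along `s ↦ (a + s v, b - s̄ v)`. Its sections then satisfy a common linear
recurrence with constant coefficients along `v`.

With `x₀, y₀` a maximal nonvanishing minor, `det Φ(x + s v, y₀ - s̄ v)` is the product of
`det Φ(x + s v, y₀)` and `det Φ(x₀, y₀ - s̄ v)` up to a constant. Conjugating the second factor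
makes the product entire, hence a polynomial in `s` of degree bounded independently of `x`; its
vanishing iterated difference is a recurrence for `det Φ(x, y₀)`, and letting one entry of `x` vary
gives one for the sections of `Φ`. -/
theorem exists_recurrence {Φ : A → A → ℂ} {r : ℕ} (v : A)
    (hleft : ∀ a b, Differentiable ℂ fun s : ℂ => Φ (a + s • v) b)
    (hright : ∀ a b, Differentiable ℂ fun s : ℂ => Φ a (b + s • v)) {N : ℕ}
    (hgrowth : ∀ a b, ∃ C : ℝ, ∀ s : ℂ, ‖Φ (a + s • v) (b - conj s • v)‖ ≤ C * (1 + ‖s‖) ^ N)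
    (hr : ∀ x y : Fin (r + 1) → A, (minor Φ x y).det = 0) :
    ∃ c : ℂ, c ≠ 0 ∧ ∃ p : Polynomial ℂ, p.Monic ∧
      ∀ a b, ∑ l ∈ Finset.range (p.natDegree + 1), p.coeff l * Φ (a + (l * c) • v) b = 0 := by
  obtain ⟨ρ, -, x₀, y₀, hdet, hfac⟩ := exists_minor_factorization Φ r hr
  set M₀ := minor Φ x₀ y₀ with hM₀
  have hmul : ∀ x y : Fin ρ → A,
      (minor Φ x y).det * M₀.det = (minor Φ x y₀).det * (minor Φ x₀ y).det := by
    intro x y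
    have : minor Φ x y = minor Φ x y₀ * M₀⁻¹ * minor Φ x₀ y := by
      ext i j
      rw [minor_apply, hfac, Matrix.mul_assoc]
      simp only [Matrix.mul_apply, minor_apply, Finset.mul_sum, mul_assoc]
    rw [this, Matrix.det_mul, Matrix.det_mul, mul_right_comm, mul_assoc (minor Φ x y₀).det,
      ← Matrix.det_mul, Matrix.nonsing_inv_mul _ (isUnit_iff_ne_zero.mpr hdet), Matrix.det_one,
      mul_one]
  set D : (Fin ρ → A) → ℂ := fun x => (minor Φ x y₀).det with hD
  set K : ℂ → ℂ := fun t => (minor Φ x₀ fun j => y₀ j + t • v).det with hK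
  have hKdiff : Differentiable ℂ K := differentiable_det fun i j => hright _ _
  set k : ℂ → ℂ := fun s => conj (K (-conj s)) with hk
  have hkdiff : Differentiable ℂ k := by
    have h1 : Differentiable ℂ fun s => K (-s) := hKdiff.comp differentiable_neg
    intro s
    have h2 := (h1 (conj s)).conj_conj
    rw [Complex.conj_conj] at h2
    exact h2
  have hk0 : k 0 ≠ 0 := by
    have : K 0 = M₀.det := by simp [hK, hM₀]
    simp only [hk, map_zero, neg_zero, this]
    exact (map_ne_zero _).mpr hdet
  set m := N * ρ + 1 with hm
  have hrel : ∀ (x : Fin ρ → A) (c : ℂ), ∑ l ∈ Finset.range (m + 1),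
      ((-1) ^ (m - l) * (m.choose l : ℂ) * k (l * c)) * D (fun i => x i + (l * c) • v) = 0 := by
    intro x c
    have hf : Differentiable ℂ fun s => k s * D fun i => x i + s • v :=
      hkdiff.mul (differentiable_det fun i j => hleft _ _)
    obtain ⟨C, hC⟩ := exists_norm_det_le (N := N)
      (M := fun s => minor Φ (fun i => x i + s • v) fun j => y₀ j - conj s • v)
      fun i j => hgrowth (x i) (y₀ j)
    have hb : ∀ s, ‖k s * D fun i => x i + s • v‖ ≤ (C * ‖M₀.det‖) * (1 + ‖s‖) ^ (N * ρ) := by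
      intro s
      have h1 := hmul (fun i => x i + s • v) (fun j => y₀ j - conj s • v)
      have h2 : ‖k s‖ = ‖(minor Φ x₀ fun j => y₀ j - conj s • v).det‖ := by
        simp only [hk, hK, RCLike.norm_conj, neg_smul, ← sub_eq_add_neg]
      rw [norm_mul, h2, mul_comm, ← norm_mul, ← h1, norm_mul, mul_right_comm]
      exact mul_le_mul_of_nonneg_right (hC s) (norm_nonneg _)
    have := sum_choose_mul_eq_zero_of_growth hf hb c
    simpa only [mul_assoc] using this
  -- a small shift keeps all the coefficients `k (l c)` away from zero
  obtain ⟨c, hc0, hc⟩ : ∃ c : ℂ, c ≠ 0 ∧ ∀ l ∈ Finset.range (m + 1), k (l * c) ≠ 0 := by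
    have h1 : ∀ᶠ c in 𝓝 (0 : ℂ), ∀ l ∈ Finset.range (m + 1), k (l * c) ≠ 0 := by
      rw [Filter.eventually_all_finset]
      intro l _
      have : ContinuousAt (fun c : ℂ => k (l * c)) 0 :=
        (hkdiff.continuous.comp (continuous_const.mul continuous_id)).continuousAt
      refine this.eventually_ne ?_
      simpa using hk0
    obtain ⟨c, h, h0⟩ := ((h1.filter_mono nhdsWithin_le_nhds).and
      (eventually_mem_nhdsWithin (a := (0 : ℂ)) (s := {0}ᶜ))).exists
    exact ⟨c, h0, h⟩
  set V : Submodule ℂ (A → ℂ) := Submodule.span ℂ (Set.range fun j a => Φ a (y₀ j)) with hV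
  have : FiniteDimensional ℂ V := FiniteDimensional.span_of_finite ℂ (Set.finite_range _)
  have hmemV : ∀ (x : Fin ρ → A) (i : Fin ρ), (fun a => D (Function.update x i a)) ∈ V := by
    intro x i
    have : (fun a => D (Function.update x i a)) = ∑ j,
        (minor Φ x y₀).transpose.adjugate i j • fun a => Φ a (y₀ j) := by
      funext a
      simp only [hD, det_minor_update, Matrix.cramer_eq_adjugate_mulVec, Matrix.mulVec, dotProduct,
        Finset.sum_apply, Pi.smul_apply, smul_eq_mul]
    rw [this]
    exact Submodule.sum_mem _ fun j _ => Submodule.smul_mem _ _ (Submodule.subset_span ⟨j, rfl⟩)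
  have hVle : V ≤ Submodule.span ℂ (Set.range fun i a => D (Function.update x₀ i a)) := by
    refine Submodule.span_le.mpr ?_
    rintro _ ⟨j, rfl⟩
    have : (fun a => Φ a (y₀ j)) = M₀.det⁻¹ • ∑ i, Φ (x₀ i) (y₀ j) •
        fun a => D (Function.update x₀ i a) := by
      funext a
      have h1 := congrFun (Matrix.mulVec_cramer M₀.transpose fun j => Φ a (y₀ j)) j
      rw [Matrix.det_transpose] at h1
      simp only [Matrix.mulVec, dotProduct, Pi.smul_apply, smul_eq_mul, hM₀, ← det_minor_update,
        Matrix.transpose_apply, minor_apply] at h1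
      simp only [hD, Pi.smul_apply, Finset.sum_apply, smul_eq_mul, h1]
      rw [← hM₀, inv_mul_cancel_left₀ hdet]
    change (fun a => Φ a (y₀ j)) ∈ _
    rw [this]
    exact Submodule.smul_mem _ _ (Submodule.sum_mem _ fun j _ =>
      Submodule.smul_mem _ _ (Submodule.subset_span ⟨j, rfl⟩))
  set τ : Module.End ℂ (A → ℂ) := LinearMap.funLeft ℂ ℂ fun a => a + c • v with hτ
  have hτpow : ∀ (l : ℕ) (f : A → ℂ) (a : A), (τ ^ l) f a = f (a + (l * c) • v) := by
    intro l
    induction l with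
    | zero => intro f a; simp
    | succ l ih =>
      intro f a
      rw [pow_succ]
      change (τ ^ l) (τ f) a = _
      rw [ih]
      change f (_ + c • v) = _
      congr 1
      push_cast
      rw [add_assoc, ← add_smul]
      congr 2
      ring
  -- `V` is spanned by the functions `D_i : a ↦ D (x₀ with i-th entry a)`, and the relation for `D`
  -- expresses `τ^m D_i` through translates of such functions
  have hmap : V.map (τ ^ m) ≤ ⨆ l : Fin m, V.map (τ ^ (l : ℕ)) := by
    refine (Submodule.map_mono hVle).trans ?_
    rw [Submodule.map_span, Submodule.span_le]
    rintro _ ⟨_, ⟨i, rfl⟩, rfl⟩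
    set w : ℕ → ℂ := fun l => (-1) ^ (m - l) * (m.choose l : ℂ) * k (l * c) with hw
    have hwm : w m ≠ 0 := by
      simp only [hw, Nat.sub_self, pow_zero, Nat.choose_self, Nat.cast_one, one_mul]
      exact hc m (by simp)
    -- the frozen entries of `x` are shifted back so that the leading term is a translate of `D_i`
    set g : ℕ → A → ℂ := fun l a =>
      D (Function.update (fun i' => x₀ i' - (m * c) • v + (l * c) • v) i a) with hg
    have hgV : ∀ l, g l ∈ V := fun l => hmemV _ i
    have hgm : g m = fun a => D (Function.update x₀ i a) := by
      simp only [hg, sub_add_cancel]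
    have hsum : ∑ l ∈ Finset.range (m + 1), w l • (τ ^ l) (g l) = 0 := by
      funext a
      have := hrel (Function.update (fun i' => x₀ i' - (m * c) • v) i a) c
      rw [Finset.sum_apply]
      refine Eq.trans ?_ this
      refine Finset.sum_congr rfl fun l _ => ?_
      rw [Pi.smul_apply, hτpow, smul_eq_mul]
      refine congrArg (fun t => w l * t) (congrArg D (funext fun i' => ?_))
      rcases eq_or_ne i' i with rfl | h
      · simp
      · simp [h]
    rw [Finset.sum_range_succ, hgm] at hsum
    have hlead : (τ ^ m) (fun a => D (Function.update x₀ i a))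
        = (-(w m)⁻¹) • ∑ l ∈ Finset.range m, w l • (τ ^ l) (g l) := by
      rw [eq_neg_of_add_eq_zero_left hsum, smul_neg, neg_smul, neg_neg, smul_smul,
        inv_mul_cancel₀ hwm, one_smul]
    rw [SetLike.mem_coe, hlead]
    refine Submodule.smul_mem _ _ (Submodule.sum_mem _ fun l hl => Submodule.smul_mem _ _ ?_)
    exact Submodule.mem_iSup_of_mem (⟨l, Finset.mem_range.mp hl⟩ : Fin m)
      (Submodule.mem_map_of_mem (hgV l))
  obtain ⟨p, hp, hp0⟩ := exists_monic_annihilating τ V m (by omega) hmap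
  refine ⟨c, hc0, p, hp, fun a b => ?_⟩
  have hbV : (fun a => Φ a b) ∈ V := by
    have : (fun a => Φ a b) = ∑ j, (∑ i, M₀⁻¹ j i * Φ (x₀ i) b) • fun a => Φ a (y₀ j) := by
      funext a
      rw [hfac]
      simp only [Finset.sum_apply, Pi.smul_apply, smul_eq_mul, Finset.sum_mul]
      exact Finset.sum_congr rfl fun j _ => Finset.sum_congr rfl fun i _ => by ring
    rw [this]
    exact Submodule.sum_mem _ fun j _ => Submodule.smul_mem _ _ (Submodule.subset_span ⟨j, rfl⟩)
  have := congrFun (hp0 _ hbV) a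
  rw [Polynomial.aeval_eq_sum_range, LinearMap.sum_apply, Finset.sum_apply] at this
  simpa only [LinearMap.smul_apply, Pi.smul_apply, hτpow, smul_eq_mul, Pi.zero_apply] using this

end Recurrence

/-! ### Annihilators of functionals with finite-rank moments -/

section Laplace

variable {d : ℕ}

theorem expo_add_smul_left (a b v : Fin d → ℂ) (s : ℂ) :
    expo (a + s • v) b = expo a b * expFun (s • form v 0) := by
  conv_lhs => rw [← add_zero b, ← smul_zero s]
  rw [expo_add, expo, expo, form_smul]

theorem expo_add_smul_right (a b v : Fin d → ℂ) (s : ℂ) :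
    expo a (b + s • v) = expo a b * expFun (s • form 0 v) := by
  conv_lhs => rw [← add_zero a, ← smul_zero s]
  rw [expo_add, expo, expo, form_smul]

/-- The form `s z_i - s̄ z̄_i` is purely imaginary. -/
theorem form_neg_conj_re (s : ℂ) (i : Fin d) (z : Fin d → ℂ) :
    (form (s • Pi.single i 1) (-(conj s • Pi.single i 1)) z).re = 0 := by
  rw [form_apply]
  simp [Pi.single_apply]

/-- A functional with finite-rank moments is annihilated by a polynomial in an exponential of each
coordinate. -/
theorem JetBounded.exists_annihilator {P : Smooth (Fin d → ℂ) →ₗ[ℂ] ℂ} (hP : JetBounded P) {r : ℕ}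
    (hr : MomentRankLE r P) (i : Fin d) :
    ∃ c : ℂ, c ≠ 0 ∧ ∃ p : Polynomial ℂ, p.Monic ∧ ∀ f : Smooth (Fin d → ℂ),
      HasCompactSupport (f : (Fin d → ℂ) → ℂ) →
        P (Polynomial.aeval (expo (c • Pi.single i 1) 0) p * f) = 0 := by
  set v : Fin d → ℂ := Pi.single i 1 with hv
  obtain ⟨N, hN⟩ := hP.exists_norm_expFun_le
  have hgrowth : ∀ a b, ∃ C : ℝ, ∀ s : ℂ,
      ‖laplace P (a + s • v) (b - conj s • v)‖ ≤ C * (1 + ‖s‖) ^ N := by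
    intro a b
    obtain ⟨C, hC0, hC⟩ := hN (expo a b)
    refine ⟨C * 2 ^ N, fun s => ?_⟩
    have h1 := hC (form (s • v) (-(conj s • v))) (form_neg_conj_re s i)
    rw [laplace, sub_eq_add_neg, expo_add]
    refine h1.trans ?_
    rw [mul_assoc, ← mul_pow]
    have h2 : ‖form (s • v) (-(conj s • v))‖ ≤ 2 * ‖s‖ := by
      refine ContinuousLinearMap.opNorm_le_bound _ (by positivity) fun z => ?_
      have h3 : form (s • v) (-(conj s • v)) z = s * z i - conj s * conj (z i) := by
        rw [form_apply]
        simp [hv, Pi.single_apply, sub_eq_add_neg]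
      rw [h3]
      refine (norm_sub_le _ _).trans ?_
      rw [norm_mul, norm_mul, RCLike.norm_conj, RCLike.norm_conj]
      have := mul_le_mul_of_nonneg_left (norm_le_pi_norm z i) (norm_nonneg s)
      linarith
    gcongr
    linarith
  obtain ⟨c, hc, p, hp, hrec⟩ := exists_recurrence (Φ := laplace P) v
    (fun a b => by
      simp only [laplace, expo_add_smul_left]
      exact hP.differentiable_expFun _ _)
    (fun a b => by
      simp only [laplace, expo_add_smul_right]
      exact hP.differentiable_expFun _ _)
    hgrowth (hr.det_minor_laplace hP)
  refine ⟨c, hc, p, hp, fun f hf => hP.mul_eq_zero_of_expo _ (fun a b => ?_) f hf⟩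
  have hpow : ∀ l : ℕ, expo (c • v) 0 ^ l = expo ((l * c) • v) (0 : Fin d → ℂ) := by
    intro l
    induction l with
    | zero => simp [expo_zero]
    | succ l ih =>
      rw [pow_succ, ih, ← expo_add, add_zero, ← add_smul]
      congr 2
      push_cast
      ring
  rw [Polynomial.aeval_eq_sum_range, Finset.sum_mul, map_sum, ← hrec a b]
  refine Finset.sum_congr rfl fun l _ => ?_
  rw [smul_mul_assoc, map_smul, hpow, ← expo_add, zero_add, smul_eq_mul, add_comm _ a]
  rfl

end Laplace

/-! ### Extending distributions to smooth functions -/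

section Extension

variable {d : ℕ}

theorem Smooth.contDiff_re (f : Smooth (Fin d → ℂ)) :
    ContDiff ℝ ∞ fun z => ((f : (Fin d → ℂ) → ℂ) z).re :=
  Complex.reCLM.contDiff.comp (Smooth.contDiff f)

theorem Smooth.contDiff_im (f : Smooth (Fin d → ℂ)) :
    ContDiff ℝ ∞ fun z => ((f : (Fin d → ℂ) → ℂ) z).im :=
  Complex.imCLM.contDiff.comp (Smooth.contDiff f)

/-- The extension of a distribution, cut off by a test function `χ`, to a complex-linear functional
on smooth functions. -/
def extend (F : Dist d) (χ : Test d) : Smooth (Fin d → ℂ) →ₗ[ℂ] ℂ where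
  toFun f := F (mulTest _ (Smooth.contDiff_re f) χ) +
    Complex.I * F (mulTest _ (Smooth.contDiff_im f) χ)
  map_add' f g := by
    have h1 : mulTest _ (Smooth.contDiff_re (f + g)) χ
        = mulTest _ (Smooth.contDiff_re f) χ + mulTest _ (Smooth.contDiff_re g) χ := by
      ext z
      exact add_mul _ _ _
    have h2 : mulTest _ (Smooth.contDiff_im (f + g)) χ
        = mulTest _ (Smooth.contDiff_im f) χ + mulTest _ (Smooth.contDiff_im g) χ := by
      ext z
      exact add_mul _ _ _
    rw [h1, h2, map_add, map_add]
    ring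
  map_smul' c f := by
    have h1 : mulTest _ (Smooth.contDiff_re (c • f)) χ
        = c.re • mulTest _ (Smooth.contDiff_re f) χ
          - c.im • mulTest _ (Smooth.contDiff_im f) χ := by
      ext z
      change (c * (f : (Fin d → ℂ) → ℂ) z).re * χ z = c.re * (_ * χ z) - c.im * (_ * χ z)
      rw [Complex.mul_re]
      ring
    have h2 : mulTest _ (Smooth.contDiff_im (c • f)) χ
        = c.re • mulTest _ (Smooth.contDiff_im f) χ
          + c.im • mulTest _ (Smooth.contDiff_re f) χ := by
      ext z
      change (c * (f : (Fin d → ℂ) → ℂ) z).im * χ z = c.re * (_ * χ z) + c.im * (_ * χ z)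
      rw [Complex.mul_im]
      ring
    rw [h1, h2, map_sub, map_add, map_smul, map_smul, map_smul, map_smul]
    simp only [Complex.real_smul, RingHom.id_apply, smul_eq_mul]
    conv_rhs => rw [← Complex.re_add_im c]
    linear_combination (c.im : ℂ) * F (mulTest _ (Smooth.contDiff_im f) χ) * (-Complex.I_mul_I)

theorem extend_apply (F : Dist d) (χ : Test d) (f : Smooth (Fin d → ℂ)) :
    extend F χ f = F (mulTest _ (Smooth.contDiff_re f) χ) +
      Complex.I * F (mulTest _ (Smooth.contDiff_im f) χ) := rfl

/-- On test functions supported in a fixed compact set a distribution is controlled by finitely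
many derivatives. -/
theorem exists_norm_le_of_jet (F : Dist d) (K : Compacts (Fin d → ℂ)) :
    ∃ (N : ℕ) (C : ℝ), 0 ≤ C ∧ ∀ (φ : Test d) (A : ℝ), tsupport φ ⊆ K → 0 ≤ A →
      (∀ k ≤ N, ∀ z ∈ K, ‖iteratedFDeriv ℝ k φ z‖ ≤ A) → ‖F φ‖ ≤ C * A := by
  set G : 𝓓_{K}(Fin d → ℂ, ℝ) →L[ℝ] ℂ :=
    F.comp (TestFunction.ofSupportedInCLM ℝ (Ω := ⊤) (Set.subset_univ _)) with hG
  have hcont : Continuous ((normSeminorm ℝ ℂ).comp G.toLinearMap) :=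
    continuous_norm.comp G.continuous
  obtain ⟨s, C, -, hC⟩ := Seminorm.bound_of_continuous
    (ContDiffMapSupportedIn.withSeminorms ℝ (Fin d → ℂ) ℝ ⊤ K) _ hcont
  refine ⟨s.sup id, C, C.2, fun φ A hφ hA hb => ?_⟩
  set ψ : 𝓓_{K}(Fin d → ℂ, ℝ) :=
    ContDiffMapSupportedIn.of_support_subset φ.contDiff ((subset_tsupport _).trans hφ)
  have h1 : F φ = G ψ := rfl
  rw [h1]
  refine (hC ψ).trans ?_
  rw [smul_apply, NNReal.smul_def, smul_eq_mul]
  refine mul_le_mul_of_nonneg_left (Seminorm.finset_sup_apply_le hA fun i hi => ?_) C.2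
  rw [ContDiffMapSupportedIn.seminorm_top_le_iff ℝ hA]
  exact fun z hz => hb i (Finset.le_sup (f := id) hi) z hz

theorem jetBounded_extend (F : Dist d) (χ : Test d) : JetBounded (extend F χ) := by
  set K : Compacts (Fin d → ℂ) := ⟨tsupport χ, χ.hasCompactSupport⟩ with hK
  obtain ⟨N, C, hC0, hC⟩ := exists_norm_le_of_jet F K
  set χ' : Smooth (Fin d → ℂ) := ⟨fun z => (χ z : ℂ), (Complex.ofRealCLM.contDiff.comp χ.contDiff :
    ContDiff ℝ ∞ fun z => (χ z : ℂ))⟩ with hχ'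
  obtain ⟨B, hB0, hB⟩ := Smooth.exists_jet_bound χ' K.isCompact N
  have key : ∀ (f : Smooth (Fin d → ℂ)) (A : ℝ), 0 ≤ A →
      (∀ k ≤ N, ∀ z ∈ K, ‖iteratedFDeriv ℝ k (f : (Fin d → ℂ) → ℂ) z‖ ≤ A) →
      ∀ (T : ℂ →L[ℝ] ℝ), ‖T‖ ≤ 1 → ∀ h : ContDiff ℝ ∞ (fun z => T ((f : (Fin d → ℂ) → ℂ) z)),
        ‖F (mulTest _ h χ)‖ ≤ C * (2 ^ N * B * A) := by
    intro f A hA hf T hT h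
    refine hC _ _ tsupport_mul_subset_right (by positivity) fun k hk z hz => ?_
    have h1 : ((mulTest _ h χ : Test d) : (Fin d → ℂ) → ℝ)
        = T ∘ ((χ' * f : Smooth (Fin d → ℂ)) : (Fin d → ℂ) → ℂ) := by
      funext w
      change T _ * χ w = T ((χ w : ℂ) * _)
      rw [← Complex.real_smul, map_smul, smul_eq_mul, mul_comm]
    rw [h1]
    refine (ContinuousLinearMap.norm_iteratedFDeriv_comp_left T
      (Smooth.contDiff (χ' * f)).contDiffAt (mod_cast le_top)).trans ?_
    refine (mul_le_of_le_one_left (norm_nonneg _) hT).trans ?_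
    exact Smooth.norm_iteratedFDeriv_mul_le hA hB0 (fun k hk => hB k hk z hz)
      (fun k hk => hf k hk z hz) hk
  refine ⟨K, N, 2 * (C * (2 ^ N * B)), K.isCompact, fun f A hA hf => ?_⟩
  have h1 := key f A hA hf Complex.reCLM Complex.reCLM_norm.le (Smooth.contDiff_re f)
  have h2 := key f A hA hf Complex.imCLM Complex.imCLM_norm.le (Smooth.contDiff_im f)
  rw [extend_apply]
  refine (norm_add_le _ _).trans ?_
  rw [norm_mul, Complex.norm_I, one_mul]
  refine (add_le_add h1 h2).trans (le_of_eq ?_)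
  ring

theorem exists_test_eq_one {K : Set (Fin d → ℂ)} (hK : IsCompact K) :
    ∃ χ : Test d, ∀ᶠ z in 𝓝ˢ K, χ z = 1 := by
  obtain ⟨R, hR0, hR⟩ := hK.isBounded.subset_ball_lt 0 0
  let b : ContDiffBump (0 : Fin d → ℂ) := ⟨R, R + 1, hR0, by linarith⟩
  refine ⟨⟨b, b.contDiff, b.hasCompactSupport, fun _ _ => trivial⟩, ?_⟩
  filter_upwards [Metric.isOpen_ball.mem_nhdsSet.mpr hR] with z hz
  exact b.one_of_mem_closedBall (Metric.ball_subset_closedBall hz)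

theorem pairing_eq_extend {F : Dist d} {χ : Test d} (hχ : ∀ᶠ z in 𝓝ˢ (dsupport F), χ z = 1)
    (f : Smooth (Fin d → ℂ)) : pairing F f = extend F χ f := by
  refine pairing_eq F f _ _ (hχ.mono fun z hz => ?_)
  change _ = (((f : (Fin d → ℂ) → ℂ) z).re * χ z : ℝ) +
    Complex.I * (((f : (Fin d → ℂ) → ℂ) z).im * χ z : ℝ)
  rw [hz, mul_one, mul_one, mul_comm Complex.I, Complex.re_add_im]

theorem extend_eq_zero {F : Dist d} (χ : Test d) {f : Smooth (Fin d → ℂ)}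
    (hf : ∀ᶠ z in 𝓝ˢ (dsupport F), (f : (Fin d → ℂ) → ℂ) z = 0) : extend F χ f = 0 := by
  rw [extend_apply, apply_eq_zero_of_eventually F, apply_eq_zero_of_eventually F, mul_zero,
    add_zero]
  · refine hf.mono fun z hz => ?_
    change ((f : (Fin d → ℂ) → ℂ) z).im * χ z = 0
    rw [hz, Complex.zero_im, zero_mul]
  · refine hf.mono fun z hz => ?_
    change ((f : (Fin d → ℂ) → ℂ) z).re * χ z = 0
    rw [hz, Complex.zero_re, zero_mul]

/-- A real test function as a complex smooth function. -/
def ofTest (φ : Test d) : Smooth (Fin d → ℂ) :=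
  ⟨fun z => (φ z : ℂ), (Complex.ofRealCLM.contDiff.comp φ.contDiff :
    ContDiff ℝ ∞ fun z => (φ z : ℂ))⟩

@[simp] theorem ofTest_apply (φ : Test d) (z : Fin d → ℂ) :
    (ofTest φ : (Fin d → ℂ) → ℂ) z = (φ z : ℂ) := rfl

theorem extend_ofTest {F : Dist d} {χ : Test d} (hχ : ∀ᶠ z in 𝓝ˢ (dsupport F), χ z = 1)
    (φ : Test d) : extend F χ (ofTest φ) = F φ := by
  rw [extend_apply, apply_eq_zero_of_eventually F (mulTest _ (Smooth.contDiff_im (ofTest φ)) χ),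
    mul_zero, add_zero]
  · refine apply_congr F _ _ (hχ.mono fun z hz => ?_)
    change (φ z : ℂ).re * χ z = φ z
    rw [hz, mul_one, Complex.ofReal_re]
  · refine Eventually.of_forall fun z => ?_
    change (φ z : ℂ).im * χ z = 0
    rw [Complex.ofReal_im, zero_mul]

theorem hasCompactSupport_ofTest (φ : Test d) :
    HasCompactSupport (ofTest φ : (Fin d → ℂ) → ℂ) :=
  φ.hasCompactSupport.comp_left (g := fun x : ℝ => (x : ℂ)) Complex.ofReal_zero

theorem hol_mono_apply (α : Fin d → ℕ) (z : Fin d → ℂ) :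
    (hol (mono α) : (Fin d → ℂ) → ℂ) z = ∏ i, z i ^ α i := by
  simp [hol, mono, coord, Finset.prod_apply]

theorem anti_mono_apply (β : Fin d → ℕ) (z : Fin d → ℂ) :
    (anti (mono β) : (Fin d → ℂ) → ℂ) z = ∏ i, conj (z i) ^ β i := by
  simp [anti, mono, conjCoord, Finset.prod_apply]

theorem momentRankLE_extend {F : Dist d} {χ : Test d} (hχ : ∀ᶠ z in 𝓝ˢ (dsupport F), χ z = 1)
    {r : ℕ} (hr : (momentMatrix F).eRank ≤ r) : MomentRankLE r (extend F χ) := by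
  intro x y
  have h1 := det_submatrix_eq_zero_of_eRank_le hr x y
  have h2 : (fun α β => momentMatrix F α β)
      = fun α β => polyForm (extend F χ) (mono α) (mono β) := by
    funext α β
    rw [polyForm_apply, ← pairing_eq_extend hχ]
    refine congrArg (pairing F) (funext fun z => ?_)
    change _ = (hol (mono α) : (Fin d → ℂ) → ℂ) z * (anti (mono β) : (Fin d → ℂ) → ℂ) z
    rw [hol_mono_apply, anti_mono_apply]
  rwa [h2] at h1

/-- A smooth function annihilating a distribution vanishes on its support: where it does not vanish,
every test function is a multiple of it. -/
theorem eq_zero_of_mem_dsupport {F : Dist d} {χ : Test d}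
    (hχ : ∀ᶠ z in 𝓝ˢ (dsupport F), χ z = 1) {g : Smooth (Fin d → ℂ)}
    (hg : ∀ f : Smooth (Fin d → ℂ), HasCompactSupport (f : (Fin d → ℂ) → ℂ) →
      extend F χ (g * f) = 0) {w : Fin d → ℂ} (hw : w ∈ dsupport F) :
    (g : (Fin d → ℂ) → ℂ) w = 0 := by
  by_contra hne
  refine (notMem_dsupport_iff w).mpr ⟨{z | (g : (Fin d → ℂ) → ℂ) z ≠ 0}, fun φ hφ => ?_,
    isOpen_ne_fun (Smooth.contDiff g).continuous continuous_const, hne⟩ hw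
  have hsm : ContDiff ℝ ∞ fun z => (φ z : ℂ) / (g : (Fin d → ℂ) → ℂ) z := by
    rw [contDiff_iff_contDiffAt]
    intro z
    by_cases hz : z ∈ tsupport φ
    · simp only [div_eq_mul_inv]
      exact (Smooth.contDiff (ofTest φ)).contDiffAt.mul
        ((Smooth.contDiff g).contDiffAt.inv (hφ hz))
    · refine (contDiffAt_const (c := (0 : ℂ))).congr_of_eventuallyEq ?_
      filter_upwards [notMem_tsupport_iff_eventuallyEq.mp hz] with x hx
      simp [hx]
  have h1 := hg ⟨_, hsm⟩ ((hasCompactSupport_ofTest φ).mono fun z hz => fun h => hz (by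
    rw [ofTest_apply] at h
    change (φ z : ℂ) / _ = 0
    rw [h, zero_div]))
  rw [← extend_ofTest hχ, ← h1]
  congr 1
  ext z
  change (φ z : ℂ) = (g : (Fin d → ℂ) → ℂ) z * ((φ z : ℂ) / (g : (Fin d → ℂ) → ℂ) z)
  by_cases hz : z ∈ tsupport φ
  · rw [mul_div_cancel₀ _ (hφ hz)]
  · rw [image_eq_zero_of_notMem_tsupport hz, Complex.ofReal_zero, zero_div, mul_zero]

end Extension

/-! ### Finiteness of the support -/

section FiniteSupport

variable {d : ℕ}

/-- A nonzero polynomial in `exp (c t)` has finitely many zeros in a compact set. -/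
theorem finite_zeros_exp {c : ℂ} (hc : c ≠ 0) {p : Polynomial ℂ} (hp : p ≠ 0) {K : Set ℂ}
    (hK : IsCompact K) : {t ∈ K | p.eval (Complex.exp (c * t)) = 0}.Finite := by
  by_contra hinf
  obtain ⟨t₀, -, ht₀⟩ := Set.Infinite.exists_accPt_of_subset_isCompact hinf hK (Set.sep_subset _ _)
  have hdiff : Differentiable ℂ fun t => p.eval (Complex.exp (c * t)) :=
    p.differentiable.comp (Complex.differentiable_exp.comp (differentiable_id.const_mul c))
  have h1 := AnalyticOnNhd.eqOn_zero_of_preconnected_of_frequently_eq_zero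
    (fun t _ => hdiff.analyticAt t) isPreconnected_univ (Set.mem_univ t₀)
    ((accPt_iff_frequently_nhdsNE.mp ht₀).mono fun t ht => ht.2)
  refine hp (Polynomial.eq_zero_of_infinite_isRoot p ?_)
  refine (Set.infinite_of_injective_forall_mem (f := fun n : ℕ => ((n : ℂ) + 1)) ?_ fun n => ?_)
  · intro a b hab
    simpa using hab
  · have h2 := h1 (Set.mem_univ (Complex.log ((n : ℂ) + 1) / c))
    change p.eval _ = 0 at h2
    rwa [mul_div_cancel₀ _ hc, Complex.exp_log (Nat.cast_add_one_ne_zero n)] at h2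

theorem finite_dsupport {F : Dist d} (hF : IsCompact (dsupport F)) {r : ℕ}
    (hr : (momentMatrix F).eRank ≤ r) : (dsupport F).Finite := by
  obtain ⟨χ, hχ⟩ := exists_test_eq_one hF
  have hP := jetBounded_extend F χ
  choose c hc p hp hkill using hP.exists_annihilator (momentRankLE_extend hχ hr)
  refine (Set.Finite.pi' fun i => finite_zeros_exp (hc i) (hp i).ne_zero
    (hF.image (continuous_apply i))).subset fun w hw i => ⟨⟨w, hw, rfl⟩, ?_⟩
  have h1 := eq_zero_of_mem_dsupport hχ (hkill i) hw
  have h2 : ∀ q : Polynomial ℂ,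
      ((Polynomial.aeval (expo (c i • Pi.single i 1) 0) q : Smooth (Fin d → ℂ)) :
        (Fin d → ℂ) → ℂ) w = q.eval (Complex.exp (c i * w i)) := by
    intro q
    have h3 : (expo (c i • Pi.single i 1) 0 : (Fin d → ℂ) → ℂ) w = Complex.exp (c i * w i) := by
      simp [expo, form_apply, Pi.single_apply]
    rw [Polynomial.aeval_eq_sum_range, Polynomial.eval_eq_sum_range, ← h3]
    simp [Finset.sum_apply]
  rwa [h2] at h1

end FiniteSupport

/-! ### Distributions supported at finitely many points -/

section Representation

variable {d : ℕ}

/-- Transposing the derivatives one by one reverses their order. -/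
theorem iteratedLineDerivOp_diracAt_apply {k : ℕ} (m : Fin k → (Fin d → ℂ)) (w : Fin d → ℂ)
    (φ : Test d) : (∂^{m} (diracAt w) : Dist d) φ
      = (-1) ^ k * iteratedFDeriv ℝ k (ofTest φ : (Fin d → ℂ) → ℂ) w (m ∘ Fin.rev) := by
  induction k generalizing φ with
  | zero => simp [diracAt]
  | succ k ih =>
    rw [iteratedLineDerivOp_succ_left, lineDerivOp_apply_apply, map_neg, ih,
      iteratedFDeriv_succ_apply_right]
    have h1 : ((ofTest (∂_{m 0} φ) : Smooth (Fin d → ℂ)) : (Fin d → ℂ) → ℂ)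
        = fun z => fderiv ℝ (ofTest φ : (Fin d → ℂ) → ℂ) z (m 0) := by
      funext z
      have h2 : HasFDerivAt φ (fderiv ℝ φ z) z :=
        (φ.contDiff.differentiable (by simp) z).hasFDerivAt
      have h3 := (Complex.ofRealCLM.hasFDerivAt.comp z h2).fderiv
      change ((∂_{m 0} φ) z : ℂ) = fderiv ℝ (fun z => (φ z : ℂ)) z (m 0)
      change fderiv ℝ (fun z => (φ z : ℂ)) z = _ at h3
      rw [h3, TestFunction.lineDerivOp_eq_lineDerivCLM (𝕜 := ℝ),
        TestFunction.lineDerivCLM_eq_fderivCLM (𝕜 := ℝ)]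
      simp [TestFunction.fderivCLM_apply]
    have h4 : ContDiff ℝ k (fderiv ℝ (ofTest φ : (Fin d → ℂ) → ℂ)) :=
      (Smooth.contDiff (ofTest φ)).fderiv_right (mod_cast le_top)
    rw [h1, iteratedFDeriv_clm_apply_const_apply h4 le_rfl, pow_succ]
    have h5 : Fin.init (m ∘ Fin.rev) = Fin.tail m ∘ Fin.rev := by
      funext i
      simp [Fin.init, Fin.tail, Fin.rev_castSucc]
    have h6 : (m ∘ Fin.rev) (Fin.last k) = m 0 := by simp
    rw [h5, h6]
    ring

theorem DiffOp.apply_sum_single {ι : Type*} (s : Finset ι) (m : ι → Σ n : ℕ, Fin n → (Fin d → ℂ))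
    (c : ι → ℂ) (T : Dist d) :
    DiffOp.apply (∑ i ∈ s, Finsupp.single (m i) (c i)) T = ∑ i ∈ s, c i • ∂^{(m i).2} T := by
  have h := Finsupp.sum_finsetSum_index (s := s) (g := fun i => Finsupp.single (m i) (c i))
    (h := fun (m : Σ n : ℕ, Fin n → (Fin d → ℂ)) (c : ℂ) => c • (∂^{m.2} T : Dist d))
    (fun _ => zero_smul (M₀ := ℂ) (A := Dist d) _)
    fun _ _ _ => add_smul (R := ℂ) (M := Dist d) _ _ _
  rw [DiffOp.apply, ← h]
  exact Finset.sum_congr rfl fun i _ => Finsupp.sum_single_index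
    (zero_smul (M₀ := ℂ) (A := Dist d) _)

theorem isSumOfDeltas_of_eq_sum {F : Dist d} {r : ℕ} {Z : Finset (Fin d → ℂ)} (hZ : Z.card ≤ r)
    (L : (Fin d → ℂ) → DiffOp d) (h : F = ∑ w ∈ Z, (L w).apply (diracAt w)) :
    IsSumOfDeltas r F := by
  obtain ⟨e⟩ : Nonempty (Z ↪ Fin r) :=
    Function.Embedding.nonempty_of_card_le (by simpa using hZ)
  refine ⟨Function.extend e (fun z => z.1) 0, Function.extend e (fun z => L z.1) 0, ?_⟩
  rw [h, ← Finset.sum_coe_sort]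
  refine Fintype.sum_of_injective e e.injective _ _ (fun q hq => ?_) fun z => ?_
  · rw [Function.extend_apply' (fun z : Z => L z.1) _ _ hq]
    exact Finsupp.sum_zero_index
  · rw [e.injective.extend_apply, e.injective.extend_apply]

theorem flatAt_iff_basis {ι : Type*} [Finite ι] (b : Module.Basis ι ℝ (Fin d → ℂ)) {n : ℕ}
    {f : Smooth (Fin d → ℂ)} {w : Fin d → ℂ} : FlatAt n f w ↔
      ∀ k < n, ∀ m : Fin k → ι, iteratedFDeriv ℝ k (f : (Fin d → ℂ) → ℂ) w (b ∘ m) = 0 := by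
  refine ⟨fun h k hk m => by rw [h k hk]; rfl, fun h k hk => ?_⟩
  refine ContinuousMultilinearMap.toMultilinearMap_injective
    (Module.Basis.ext_multilinear (fun _ => b) fun m => ?_)
  exact h k hk m

/-- A distribution annihilating all test functions that are flat at the points of a finite set is a
sum of derivatives of delta distributions at these points. -/
theorem exists_eq_sum_apply_diracAt {F : Dist d} {χ : Test d}
    (hχ : ∀ᶠ z in 𝓝ˢ (dsupport F), χ z = 1) (Z : Finset (Fin d → ℂ)) {n : ℕ}
    (h : ∀ f, (∀ w ∈ Z, FlatAt n f w) → extend F χ f = 0) :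
    ∃ L : (Fin d → ℂ) → DiffOp d, F = ∑ w ∈ Z, (L w).apply (diracAt w) := by
  let b := Module.finBasis ℝ (Fin d → ℂ)
  let I := Σ k : Fin n, Fin (k : ℕ) → Fin (Module.finrank ℝ (Fin d → ℂ))
  let Λ : Z × I → Smooth (Fin d → ℂ) →ₗ[ℂ] ℂ := fun i =>
    { toFun := fun f => iteratedFDeriv ℝ (i.2.1 : ℕ) (f : (Fin d → ℂ) → ℂ) i.1.1 (b ∘ i.2.2)
      map_add' := fun f g => by
        have := iteratedFDeriv_add_apply (𝕜 := ℝ) (i := (i.2.1 : ℕ)) (x := i.1.1)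
          ((Smooth.contDiff f).contDiffAt.of_le (mod_cast le_top))
          ((Smooth.contDiff g).contDiffAt.of_le (mod_cast le_top))
        exact congrArg (fun T => T (b ∘ i.2.2)) this
      map_smul' := fun c f => by
        have := iteratedFDeriv_const_smul_apply (𝕜 := ℝ) (i := (i.2.1 : ℕ)) (x := i.1.1) (a := c)
          ((Smooth.contDiff f).contDiffAt.of_le (mod_cast le_top))
        exact congrArg (fun T => T (b ∘ i.2.2)) this }
  have hspan : extend F χ ∈ Submodule.span ℂ (Set.range Λ) := by
    refine mem_span_of_iInf_ker_le_ker fun f hf => h f fun w hw => ?_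
    rw [flatAt_iff_basis b]
    intro k hk m
    exact (Submodule.mem_iInf _).mp hf (⟨w, hw⟩, ⟨⟨k, hk⟩, m⟩)
  obtain ⟨c, hc⟩ := (Submodule.mem_span_range_iff_exists_fun ℂ).mp hspan
  classical
  refine ⟨fun w => if hw : w ∈ Z then ∑ i : I, Finsupp.single ⟨(i.1 : ℕ), b ∘ i.2 ∘ Fin.rev⟩
    ((-1) ^ (i.1 : ℕ) * c (⟨w, hw⟩, i)) else 0, ?_⟩
  ext φ
  rw [← extend_ofTest hχ, ← hc, ← Finset.sum_coe_sort Z, LinearMap.sum_apply,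
    Fintype.sum_prod_type]
  have happ : ∀ {ι : Type} (s : Finset ι) (T : ι → Dist d), (∑ i ∈ s, T i) φ = ∑ i ∈ s, T i φ := by
    intro ι s T
    induction s using Finset.induction_on with
    | empty => rfl
    | insert a s ha ih => rw [Finset.sum_insert ha, Finset.sum_insert ha, ← ih]; rfl
  rw [happ]
  refine Finset.sum_congr rfl fun w _ => ?_
  beta_reduce
  rw [dif_pos w.2, DiffOp.apply_sum_single, happ]
  refine Finset.sum_congr rfl fun i _ => ?_
  change c (w, i) * iteratedFDeriv ℝ (i.1 : ℕ) (ofTest φ : (Fin d → ℂ) → ℂ) w.1 (b ∘ i.2)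
    = ((-1) ^ (i.1 : ℕ) * c (w, i)) * (∂^{b ∘ i.2 ∘ Fin.rev} (diracAt w.1) : Dist d) φ
  rw [iteratedLineDerivOp_diracAt_apply]
  have h1 : (b ∘ i.2 ∘ Fin.rev) ∘ Fin.rev = b ∘ i.2 := by
    funext j
    simp
  rw [h1]
  have h2 : ((-1 : ℂ) ^ (i.1 : ℕ)) * (-1) ^ (i.1 : ℕ) = 1 := by
    rw [← mul_pow]
    norm_num
  linear_combination (-(c (w, i)) * iteratedFDeriv ℝ (i.1 : ℕ)
    (ofTest φ : (Fin d → ℂ) → ℂ) w.1 (b ∘ i.2)) * h2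

end Representation

/-! ### The number of points of the support -/

section Count

/-- An algebra of smooth functions separating the points of a finite set `Z` contains a function
that is `1` to order `n` at one of them and `0` to order `n` at the others. -/
theorem exists_flat_indicator {E R : Type*} [NormedAddCommGroup E] [NormedSpace ℝ E]
    [CommRing R] [Algebra ℂ R] (Ψ : R →ₐ[ℂ] Smooth E) (Z : Finset E) (n : ℕ) {w : E}
    (hsep : ∀ w' ≠ w, ∃ p, (Ψ p : E → ℂ) w = 1 ∧ (Ψ p : E → ℂ) w' = 0) :
    ∃ p, FlatAt n (Ψ p - 1) w ∧ ∀ w' ∈ Z, w' ≠ w → FlatAt n (Ψ p) w' := by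
  classical
  have hsep' : ∀ w', ∃ p, (Ψ p : E → ℂ) w = 1 ∧ (w' ≠ w → (Ψ p : E → ℂ) w' = 0) := fun w' => by
    by_cases h : w' = w
    · exact ⟨1, by rw [map_one]; rfl, fun h' => absurd h h'⟩
    · obtain ⟨p, h1, h2⟩ := hsep w' h
      exact ⟨p, h1, fun _ => h2⟩
  choose k hk1 hk0 using hsep'
  have happ : ∀ z : E, (Ψ (∏ w' ∈ Z, k w') : E → ℂ) z = ∏ w' ∈ Z, (Ψ (k w') : E → ℂ) z := by
    intro z
    rw [map_prod]
    simp [Finset.prod_apply]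
  set u := Ψ (∏ w' ∈ Z, k w') with hu
  have hu1 : (u : E → ℂ) w = 1 := by
    rw [happ]
    exact Finset.prod_eq_one fun w' _ => hk1 w'
  -- with `u = 1` at `w` and `u = 0` at the other points, `1 - (1 - u ^ n) ^ n` is a multiple of
  -- `u ^ n` and differs from `1` by a multiple of `(1 - u ^ n) ^ n`
  refine ⟨1 - (1 - (∏ w' ∈ Z, k w') ^ n) ^ n, ?_, fun w' hw' hne => ?_⟩
  · have h1 : (1 - u ^ n : Smooth E).1 w = 0 := by
      change (1 : ℂ) - ((u : E → ℂ) w) ^ n = 0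
      rw [hu1, one_pow, sub_self]
    have h2 : Ψ (1 - (1 - (∏ w' ∈ Z, k w') ^ n) ^ n) - 1 = (-1) * (1 - u ^ n) ^ n := by
      simp only [map_sub, map_pow, map_one, ← hu]
      ring
    rw [h2]
    exact (FlatAt.pow h1 n).mul_left _
  · have h1 : (u : E → ℂ) w' = 0 := by
      rw [happ]
      exact Finset.prod_eq_zero hw' (hk0 w' hne)
    obtain ⟨q, hq⟩ : u ^ n ∣ 1 - (1 - u ^ n) ^ n := by
      have := sub_dvd_pow_sub_pow (1 : Smooth E) (1 - u ^ n) n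
      rwa [sub_sub_cancel, one_pow] at this
    have h2 : Ψ (1 - (1 - (∏ w' ∈ Z, k w') ^ n) ^ n) = q * u ^ n := by
      simp only [map_sub, map_pow, map_one, ← hu]
      rw [hq, mul_comm]
    rw [h2]
    exact (FlatAt.pow h1 n).mul_left _

variable {d : ℕ}

theorem exists_hol_separating {w w' : Fin d → ℂ} (h : w' ≠ w) :
    ∃ p : MvPolynomial (Fin d) ℂ, (hol p : (Fin d → ℂ) → ℂ) w = 1 ∧
      (hol p : (Fin d → ℂ) → ℂ) w' = 0 := by
  obtain ⟨i, hi⟩ := Function.ne_iff.mp h.symm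
  have hi' := sub_ne_zero.mpr hi
  have key : ∀ z, (hol ((w i - w' i)⁻¹ • (MvPolynomial.X i - MvPolynomial.C (w' i))) :
      (Fin d → ℂ) → ℂ) z = (w i - w' i)⁻¹ * (z i - w' i) := fun z => by
    rw [map_smul, map_sub]
    simp only [hol, MvPolynomial.aeval_X, MvPolynomial.aeval_C]
    rfl
  exact ⟨_, by rw [key, inv_mul_cancel₀ hi'], by rw [key, sub_self, mul_zero]⟩

theorem exists_anti_separating {w w' : Fin d → ℂ} (h : w' ≠ w) :
    ∃ p : MvPolynomial (Fin d) ℂ, (anti p : (Fin d → ℂ) → ℂ) w = 1 ∧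
      (anti p : (Fin d → ℂ) → ℂ) w' = 0 := by
  obtain ⟨i, hi⟩ := Function.ne_iff.mp h.symm
  have hi' : conj (w i) - conj (w' i) ≠ 0 :=
    sub_ne_zero.mpr fun h => hi ((starRingEnd ℂ).injective h)
  have key : ∀ z, (anti ((conj (w i) - conj (w' i))⁻¹ •
      (MvPolynomial.X i - MvPolynomial.C (conj (w' i)))) : (Fin d → ℂ) → ℂ) z
        = (conj (w i) - conj (w' i))⁻¹ * (conj (z i) - conj (w' i)) := fun z => by
    rw [map_smul, map_sub]
    simp only [anti, MvPolynomial.aeval_X, MvPolynomial.aeval_C]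
    rfl
  exact ⟨_, by rw [key, inv_mul_cancel₀ hi'], by rw [key, sub_self, mul_zero]⟩

/-- The rank of the moment matrix bounds the number of points of a finite support: polynomials that
localize at the points of the support make a block of the moment matrix diagonal with nonzero
entries. -/
theorem card_le_of_momentRankLE {F : Dist d} {χ : Test d}
    (hχ : ∀ᶠ z in 𝓝ˢ (dsupport F), χ z = 1) {r : ℕ} (hr : MomentRankLE r (extend F χ))
    {Z : Finset (Fin d → ℂ)} (hZ : dsupport F = Z) {n : ℕ}
    (hn : ∀ f, (∀ w ∈ Z, FlatAt n f w) → extend F χ f = 0) : Z.card ≤ r := by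
  classical
  by_contra! hlt
  have hP := jetBounded_extend F χ
  choose p hp1 hp0 using fun w => exists_flat_indicator hol Z n (w := w)
    fun w' => exists_hol_separating
  choose q hq1 hq0 using fun w => exists_flat_indicator anti Z n (w := w)
    fun w' => exists_anti_separating
  -- otherwise `F` would vanish near `w`, where the localizing function is `1` to high order
  have hne : ∀ w : Z, ∃ α β, extend F χ
      (hol (p w) * anti (q w) * (hol (mono α) * anti (mono β))) ≠ 0 := by
    rintro ⟨w, hw⟩
    by_contra! hcon
    have hkill := hP.mul_eq_zero_of_moments _ hcon
    have hw' : w ∈ dsupport F := by rw [hZ]; exact hw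
    refine (notMem_dsupport_iff w).mpr ⟨((Z.erase w : Finset _) : Set (Fin d → ℂ))ᶜ,
      fun φ hφ => ?_, (Z.erase w).finite_toSet.isClosed.isOpen_compl, by simp⟩ hw'
    have h1 := hn (ofTest φ - hol (p w) * anti (q w) * ofTest φ) fun w' hw' => ?_
    · rwa [map_sub, hkill _ (hasCompactSupport_ofTest φ), sub_zero, extend_ofTest hχ] at h1
    · rcases eq_or_ne w' w with rfl | hne
      · have h2 : ofTest φ - hol (p w') * anti (q w') * ofTest φ
            = (-ofTest φ * anti (q w')) * (hol (p w') - 1) + (-ofTest φ) * (anti (q w') - 1) := by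
          ring
        rw [h2]
        exact ((hp1 w').mul_left _).add ((hq1 w').mul_left _)
      · refine FlatAt.of_eventually_eq_zero n ?_
        have h2 : w' ∉ tsupport φ := fun h => hφ h (by simp [hne, hw'])
        filter_upwards [notMem_tsupport_iff_eventuallyEq.mp h2] with z hz
        change (φ z : ℂ) - _ * (φ z : ℂ) = 0
        rw [hz, Pi.zero_apply, Complex.ofReal_zero, mul_zero, sub_zero]
  choose α β hαβ using hne
  obtain ⟨x⟩ : Nonempty (Fin (r + 1) ↪ Z) :=
    Function.Embedding.nonempty_of_card_le (by simpa using hlt)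
  obtain ⟨ρ, hρ, α', β', N, hfac⟩ := hr.exists_factorization
  have hdet := det_minor_eq_zero_of_factorization (Nat.lt_succ_of_le hρ)
    (Φ := fun a b => polyForm (extend F χ) a b)
    (u := fun a j => polyForm (extend F χ) a (mono (β' j)))
    (v := fun j b => ∑ i, N j i * polyForm (extend F χ) (mono (α' i)) b)
    (fun a b => by rw [hfac]; simp only [Finset.mul_sum, mul_assoc])
    (fun i => p (x i) * mono (α (x i))) (fun i => q (x i) * mono (β (x i)))
  have hdiag : minor (fun a b => polyForm (extend F χ) a b)
      (fun i => p (x i) * mono (α (x i))) (fun i => q (x i) * mono (β (x i)))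
      = Matrix.diagonal fun i => extend F χ (hol (p (x i)) * anti (q (x i)) *
        (hol (mono (α (x i))) * anti (mono (β (x i))))) := by
    ext i j
    rw [minor_apply, polyForm_apply, map_mul hol, map_mul anti]
    rcases eq_or_ne i j with rfl | hij
    · rw [Matrix.diagonal_apply_eq]
      refine congrArg _ ?_
      ring
    · rw [Matrix.diagonal_apply_ne _ hij]
      refine hn _ fun w hw => ?_
      have hxij : (x i : Fin d → ℂ) ≠ x j := fun h => hij (x.injective (Subtype.ext h))
      rcases eq_or_ne w (x i) with rfl | hwi
      · have := ((hq0 _ _ hw hxij).mul_left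
          (hol (p (x i)) * hol (mono (α (x i))) * anti (mono (β (x j)))))
        convert this using 1
        ring
      · have := ((hp0 _ _ hw hwi).mul_left
          (hol (mono (α (x i))) * (anti (q (x j)) * anti (mono (β (x j))))))
        convert this using 1
        ring
  rw [hdiag, Matrix.det_diagonal] at hdet
  exact Finset.prod_ne_zero_iff.mpr (fun i _ => hαβ (x i)) hdet

/-- A compactly supported distribution whose moment matrix has rank at most `r` is a sum of
derivatives of delta distributions at no more than `r` points. -/
theorem encard_dsupport_le_and_isSumOfDeltas {F : Dist d} (hF : IsCompact (dsupport F)) {r : ℕ}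
    (hr : (momentMatrix F).eRank ≤ r) :
    (dsupport F).encard ≤ (r : ℕ∞) ∧ IsSumOfDeltas r F := by
  obtain ⟨χ, hχ⟩ := exists_test_eq_one hF
  set Z := (finite_dsupport hF hr).toFinset with hZdef
  have hZ : dsupport F = Z := (Set.Finite.coe_toFinset _).symm
  obtain ⟨n, hn⟩ := (jetBounded_extend F χ).exists_eq_zero_of_flatAt Z fun f hf => by
    refine extend_eq_zero χ (eventually_nhdsSet_iff_forall.mpr fun w hw => hf w ?_)
    rw [hZ] at hw
    exact hw
  have hcard := card_le_of_momentRankLE hχ (momentRankLE_extend hχ hr) hZ hn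
  obtain ⟨L, hL⟩ := exists_eq_sum_apply_diracAt hχ Z hn
  refine ⟨?_, isSumOfDeltas_of_eq_sum hcard L hL⟩
  rw [hZ, Set.encard_coe_eq_coe_finsetCard]
  exact_mod_cast hcard

theorem mulNear_one (F : Dist d) : mulNear (fun _ => ‖(1 : ℂ)‖ ^ 2) F = F := by
  ext φ
  rw [mulNear_apply _ F (fun _ => 1) contDiff_const (Eventually.of_forall fun z => by simp)]
  congr 1
  ext z
  rw [mulTestCLM_apply, one_mul]

end Count

end FiniteRank

end

theorem theorem4 (d r : ℕ) (F : FiniteRank.Dist d)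
    (hF : IsCompact (dsupport F)) :
    ((FiniteRank.momentMatrix F).eRank = (r : ℕ∞) →
      (dsupport F).encard ≤ (r : ℕ∞) ∧ FiniteRank.IsSumOfDeltas r F) ∧
    (∀ (c : Fin d → ℂ) (R : Fin d → ℝ),
      (∀ i, 0 < R i) →
      dsupport F ⊆ FiniteRank.polydisk c R →
      (∀ g : (Fin d → ℂ) → ℂ,
        AnalyticOnNhd ℂ g (FiniteRank.polydisk c R) →
        (∃ M : ℝ, ∀ z ∈ FiniteRank.polydisk c R, ‖g z‖ ≤ M) →
        (FiniteRank.momentMatrix (FiniteRank.mulNear (fun z => ‖g z‖ ^ 2) F)).eRank ≤ (r : ℕ∞)) →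
      (dsupport F).encard ≤ (r : ℕ∞) ∧ FiniteRank.IsSumOfDeltas r F) := by
  refine ⟨fun h => FiniteRank.encard_dsupport_le_and_isSumOfDeltas hF h.le,
    fun c R _ _ h => FiniteRank.encard_dsupport_le_and_isSumOfDeltas hF ?_⟩
  have h1 := h (fun _ => 1) analyticOnNhd_const ⟨1, fun _ _ => norm_one.le⟩
  rwa [FiniteRank.mulNear_one] at h1
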